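/- Let $\mathbb K=\mathbb R$ or $\mathbb C$. A symplectic Lie algebra is a Lie algebra $\mathfrak g$ over $\mathbb K$ admitting a nondegenerate skew-symmetric bilinear form $\theta$ with $\theta([X,Y],Z)+\theta([Y,Z],X)+\theta([Z,X],Y)=0$ for all $X,Y,Z$. It is $2$-step nilpotent if $[\mathfrak g,[\mathfrak g,\mathfrak g]]=0\neq[\mathfrak g,\mathfrak g]$. The characteristic sequence of a nilpotent Lie algebra $\mathfrak g$ is the maximum, for the lexicographic order, over $X\in\mathfrak g\setminus[\mathfrak g,\mathfrak g]$, of the decreasing sequence of the dimensions of the Jordan blocks of $\operatorname{ad}X$. A Lie algebra is decomposable if it is the direct product of two nonzero ideals. In the following list the brackets that are not given and do not follow by skew-symmetry are zero: - $\mathfrak n_3^1$, with basis $X_1,\dots,X_3$: $[X_1,X_2]=X_3$; - $\mathfrak n_5^5$, with basis $X_1,\dots,X_5$: $[X_1,X_2]=X_3$, $[X_1,X_4]=X_5$; - $\mathfrak n_6^{19}$, with basis $X_1,\dots,X_6$: $[X_1,X_2]=X_3$, $[X_1,X_4]=X_5$, $[X_2,X_6]=X_5$; - $\mathfrak n_6^{20}$,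 with basis $X_1,\dots,X_6$: $[X_1,X_2]=X_3$, $[X_1,X_4]=X_5$, $[X_2,X_4]=X_6$; - $\mathfrak n_6^{20,1}$, with basis $X_1,\dots,X_6$: $[X_1,X_2]=X_3$, $[X_4,X_6]=X_3$, $[X_1,X_4]=X_5$, $[X_2,X_6]=-X_5$; - $\mathfrak n_7^{124}$, with basis $X_1,\dots,X_7$: $[X_1,X_2]=X_3$, $[X_4,X_7]=X_3$, $[X_1,X_4]=X_5$, $[X_6,X_7]=X_5$. Write $\mathbb K^m$ for the abelian Lie algebra of dimension $m$, and $\oplus$ for the direct product of Lie algebras. **Theorem.** 1. Every $8$-dimensional $2$-step nilpotent symplectic Lie algebra over $\mathbb K$ with characteristic sequence $(2,2,1,1,1,1)$ is decomposable. 2. In particular, let $\mathcal C_1(\mathcal F^{8,2}_{2,4})$ be the family of the $8$-dimensional Lie algebras over $\mathbb K$ having a basis $X_1,\dots,X_8$ such that $[X_1,X_2]=X_3$, $[X_1,X_4]=X_5$, $[X_1,X_i]=0$ for $i=6,7,8$, $[X_i,X_j]\in\mathbb K X_3+\mathbb K X_5$ for $i,j\in\{2,4,6,7,8\}$, and $X_3,X_5$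 are central. Every symplectic Lie algebra in this family is decomposable. 3. A complex Lie algebra is $8$-dimensional, $2$-step nilpotent and symplectic with characteristic sequence $(2,2,1,1,1,1)$ if and only if it is isomorphic to one of $$\mathfrak n_7^{124}\oplus\mathbb C,\quad \mathfrak n_6^{19}\oplus\mathbb C^2,\quad \mathfrak n_6^{20}\oplus\mathbb C^2,\quad \mathfrak n_5^5\oplus\mathbb C^3,\quad \mathfrak n_3^1\oplus\mathfrak n_3^1\oplus\mathbb C^2.$$ 4. A real Lie algebra is $8$-dimensional, $2$-step nilpotent and symplectic with characteristic sequence $(2,2,1,1,1,1)$ if and only if it is isomorphic to one of $$\mathfrak n_7^{124}\oplus\mathbb R,\quad \mathfrak n_6^{19}\oplus\mathbb R^2,\quad \mathfrak n_6^{20}\oplus\mathbb R^2,\quad \mathfrak n_6^{20,1}\oplus\mathbb R^2,\quad \mathfrak n_5^5\oplus\mathbb R^3,\quad \mathfrak n_3^1\oplus\mathfrak n_3^1\oplus\mathbb R^2.$$ -/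

import Mathlib

namespace SympLie

/-! ### Symplectic Lie algebras, nilindex, decomposability -/

section General

variable (K : Type*) [Field K] (L : Type*) [LieRing L] [LieAlgebra K L]

/-- A symplectic form on a Lie algebra: a nondegenerate alternating bilinear form that is closed for
the Chevalley-Eilenberg differential. -/
def IsSymplecticForm (θ : LinearMap.BilinForm K L) : Prop :=
  θ.IsAlt ∧ θ.Nondegenerate ∧
    ∀ x y z : L, θ ⁅x, y⁆ z + θ ⁅y, z⁆ x + θ ⁅z, x⁆ y = 0

/-- A Lie algebra is symplectic if it admits a symplectic form. -/
def IsSymplectic : Prop := ∃ θ : LinearMap.BilinForm K L, IsSymplecticForm K L θ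

/-- Nilindex exactly `2`: `C^2(L) = 0` and `C^1(L) ≠ 0` in the lower central series. -/
def IsTwoStepNilpotent : Prop :=
  LieModule.lowerCentralSeries K L L 2 = ⊥ ∧ LieModule.lowerCentralSeries K L L 1 ≠ ⊥

/-- A Lie algebra is decomposable if it is the direct product of two nonzero ideals. -/
def IsDecomposable : Prop :=
  ∃ I J : LieIdeal K L, I ≠ ⊥ ∧ J ≠ ⊥ ∧ IsCompl I J

variable {K} in
/-- `s` is the decreasing sequence of the dimensions of the Jordan blocks of the nilpotent
endomorphism `f`: the space has a basis `b i j`, with `i` the number of the block and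
`0 ≤ j < s i`, such that `f (b i 0) = 0` and `f (b i (j + 1)) = b i j`. -/
def IsJordanSequence {V : Type*} [AddCommGroup V] [Module K V] (f : V →ₗ[K] V) (s : List ℕ) :
    Prop :=
  s.Pairwise (· ≥ ·) ∧ (∀ m ∈ s, 0 < m) ∧
    ∃ b : Module.Basis (Σ i : Fin s.length, Fin (s.get i)) K V,
      ∀ (i : Fin s.length) (j : ℕ) (hj : j < s.get i),
        (j = 0 → f (b ⟨i, ⟨j, hj⟩⟩) = 0) ∧
        (∀ hj' : j + 1 < s.get i, f (b ⟨i, ⟨j + 1, hj'⟩⟩) = b ⟨i, ⟨j, hj⟩⟩)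

/-- `s` is the characteristic sequence of the nilpotent Lie algebra `L`: the greatest, for the
lexicographic order, of the Jordan sequences of `ad X`, where `X` lies outside `C^1(L)`. -/
def IsCharSequence (s : List ℕ) : Prop :=
  IsGreatest {t : List ℕ | ∃ x : L, x ∉ LieModule.lowerCentralSeries K L L 1 ∧
    IsJordanSequence (LieAlgebra.ad K L x) t} s

/-- The hypotheses on the Lie algebra: it has dimension `8`, is `2`-step nilpotent, is symplectic
and has characteristic sequence `(2,2,1,1,1,1)`. -/
def IsSymplecticOfType221111 : Prop :=
  Module.finrank K L = 8 ∧ IsTwoStepNilpotent K L ∧ IsSymplectic K L ∧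
    IsCharSequence K L [2, 2, 1, 1, 1, 1]

/-- Membership in the component `C₁` of the family of `8`-dimensional `2`-step nilpotent Lie
algebras with characteristic sequence `(2,2,1,1,1,1)` (those with `6` generators): there is a basis
`X₁, …, X₈` (here `X (i - 1)` stands for `X_i`) with `[X₁,X₂] = X₃`, `[X₁,X₄] = X₅`,
`[X₁,X_i] = 0` for `i = 6,7,8`, `[X_i,X_j] = a_{ij}^3 X₃ + a_{ij}^5 X₅` for
`i,j ∈ {2,4,6,7,8}`, and `X₃`, `X₅` central. -/
def IsInComponentOne : Prop :=
  ∃ (X : Module.Basis (Fin 8) K L) (a₃ a₅ : Fin 8 → Fin 8 → K),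
    ⁅X 0, X 1⁆ = X 2 ∧ ⁅X 0, X 3⁆ = X 4 ∧
    (∀ i ∈ ({5, 6, 7} : Set (Fin 8)), ⁅X 0, X i⁆ = 0) ∧
    (∀ i ∈ ({1, 3, 5, 6, 7} : Set (Fin 8)), ∀ j ∈ ({1, 3, 5, 6, 7} : Set (Fin 8)),
      ⁅X i, X j⁆ = a₃ i j • X 2 + a₅ i j • X 4) ∧
    (∀ i, ⁅X 2, X i⁆ = 0) ∧ (∀ i, ⁅X 4, X i⁆ = 0)

end General

/-! ### The Lie algebras of the list -/

/-- An alternating bilinear bracket on `K^n` all of whose double brackets vanish. -/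
structure BracketTable (K : Type*) [Field K] (n : ℕ) where
  br : (Fin n → K) → (Fin n → K) → (Fin n → K)
  add_left : ∀ x y z, br (x + y) z = br x z + br y z
  add_right : ∀ x y z, br x (y + z) = br x y + br x z
  smul_right : ∀ (c : K) x y, br x (c • y) = c • br x y
  self : ∀ x, br x x = 0
  nil : ∀ x y z, br x (br y z) = 0

namespace BracketTable

variable {K : Type*} [Field K] {n : ℕ}

/-- The Lie algebra with underlying space `K^n` and the given bracket. -/
def Alg (_D : BracketTable K n) : Type _ := Fin n → K

variable (D : BracketTable K n)

instance : AddCommGroup D.Alg := inferInstanceAs (AddCommGroup (Fin n → K))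

instance : Module K D.Alg := inferInstanceAs (Module K (Fin n → K))

theorem br_skew (x y : Fin n → K) : D.br x y = -D.br y x := by
  have h := D.self (x + y)
  rw [D.add_left, D.add_right, D.add_right, D.self, D.self, zero_add, add_zero] at h
  exact eq_neg_of_add_eq_zero_left h

theorem br_leibniz (x y z : Fin n → K) :
    D.br x (D.br y z) = D.br (D.br x y) z + D.br y (D.br x z) := by
  rw [D.br_skew (D.br x y) z, D.nil, D.nil, D.nil, neg_zero, add_zero]

instance : LieRing D.Alg where
  bracket x y := D.br x y
  add_lie := D.add_left
  lie_add := D.add_right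
  lie_self := D.self
  leibniz_lie := D.br_leibniz

instance : LieAlgebra K D.Alg where
  lie_smul := D.smul_right

end BracketTable

section Models

variable (K : Type*) [Field K]

/-- The abelian Lie algebra `K^m`. -/
def abelianTable (m : ℕ) : BracketTable K m where
  br _ _ := 0
  add_left _ _ _ := (add_zero 0).symm
  add_right _ _ _ := (add_zero 0).symm
  smul_right c _ _ := (smul_zero c).symm
  self _ := rfl
  nil _ _ _ := rfl

/-- `n_3^1`, the Heisenberg algebra: `[X₁,X₂] = X₃`. Here and below the coordinate number `i - 1`
is the coefficient of `X_i`. -/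
def n3_1Table : BracketTable K 3 where
  br x y := ![0, 0, x 0 * y 1 - x 1 * y 0]
  add_left x y z := by ext i; fin_cases i <;> simp; ring
  add_right x y z := by ext i; fin_cases i <;> simp; ring
  smul_right c x y := by ext i; fin_cases i <;> simp; ring
  self x := by ext i; fin_cases i <;> simp; ring
  nil x y z := by ext i; fin_cases i <;> simp

/-- `n_5^5`: `[X₁,X₂] = X₃`, `[X₁,X₄] = X₅`. -/
def n5_5Table : BracketTable K 5 where
  br x y := ![0, 0, x 0 * y 1 - x 1 * y 0, 0, x 0 * y 3 - x 3 * y 0]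
  add_left x y z := by ext i; fin_cases i <;> simp <;> ring
  add_right x y z := by ext i; fin_cases i <;> simp <;> ring
  smul_right c x y := by ext i; fin_cases i <;> simp <;> ring
  self x := by ext i; fin_cases i <;> simp <;> ring
  nil x y z := by ext i; fin_cases i <;> simp

/-- `n_6^19`: `[X₁,X₂] = X₃`, `[X₁,X₄] = X₅`, `[X₂,X₆] = X₅`. -/
def n6_19Table : BracketTable K 6 where
  br x y := ![0, 0, x 0 * y 1 - x 1 * y 0, 0,
    (x 0 * y 3 - x 3 * y 0) + (x 1 * y 5 - x 5 * y 1), 0]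
  add_left x y z := by ext i; fin_cases i <;> simp <;> ring
  add_right x y z := by ext i; fin_cases i <;> simp <;> ring
  smul_right c x y := by ext i; fin_cases i <;> simp <;> ring
  self x := by ext i; fin_cases i <;> simp <;> ring
  nil x y z := by ext i; fin_cases i <;> simp

/-- `n_6^20`: `[X₁,X₂] = X₃`, `[X₁,X₄] = X₅`, `[X₂,X₄] = X₆`. -/
def n6_20Table : BracketTable K 6 where
  br x y := ![0, 0, x 0 * y 1 - x 1 * y 0, 0, x 0 * y 3 - x 3 * y 0, x 1 * y 3 - x 3 * y 1]
  add_left x y z := by ext i; fin_cases i <;> simp <;> ring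
  add_right x y z := by ext i; fin_cases i <;> simp <;> ring
  smul_right c x y := by ext i; fin_cases i <;> simp <;> ring
  self x := by ext i; fin_cases i <;> simp <;> ring
  nil x y z := by ext i; fin_cases i <;> simp

/-- `n_6^{20,1}`: `[X₁,X₂] = X₃`, `[X₄,X₆] = X₃`, `[X₁,X₄] = X₅`, `[X₂,X₆] = -X₅`. -/
def n6_20_1Table : BracketTable K 6 where
  br x y := ![0, 0, (x 0 * y 1 - x 1 * y 0) + (x 3 * y 5 - x 5 * y 3), 0,
    (x 0 * y 3 - x 3 * y 0) - (x 1 * y 5 - x 5 * y 1), 0]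
  add_left x y z := by ext i; fin_cases i <;> simp <;> ring
  add_right x y z := by ext i; fin_cases i <;> simp <;> ring
  smul_right c x y := by ext i; fin_cases i <;> simp <;> ring
  self x := by ext i; fin_cases i <;> simp <;> ring
  nil x y z := by ext i; fin_cases i <;> simp

/-- `n_7^124`: `[X₁,X₂] = X₃`, `[X₄,X₇] = X₃`, `[X₁,X₄] = X₅`, `[X₆,X₇] = X₅`. -/
def n7_124Table : BracketTable K 7 where
  br x y := ![0, 0, (x 0 * y 1 - x 1 * y 0) + (x 3 * y 6 - x 6 * y 3), 0,
    (x 0 * y 3 - x 3 * y 0) + (x 5 * y 6 - x 6 * y 5), 0, 0]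
  add_left x y z := by ext i; fin_cases i <;> simp <;> ring
  add_right x y z := by ext i; fin_cases i <;> simp <;> ring
  smul_right c x y := by ext i; fin_cases i <;> simp <;> ring
  self x := by ext i; fin_cases i <;> simp <;> ring
  nil x y z := by ext i; fin_cases i <;> simp

/-- The abelian Lie algebra `K^m`. -/
abbrev Ab (m : ℕ) : Type _ := (abelianTable K m).Alg

/-- The Lie algebra `n_3^1`. -/
abbrev N3_1 : Type _ := (n3_1Table K).Alg

/-- The Lie algebra `n_5^5`. -/
abbrev N5_5 : Type _ := (n5_5Table K).Alg

/-- The Lie algebra `n_6^19`. -/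
abbrev N6_19 : Type _ := (n6_19Table K).Alg

/-- The Lie algebra `n_6^20`. -/
abbrev N6_20 : Type _ := (n6_20Table K).Alg

/-- The Lie algebra `n_6^{20,1}`. -/
abbrev N6_20_1 : Type _ := (n6_20_1Table K).Alg

/-- The Lie algebra `n_7^124`. -/
abbrev N7_124 : Type _ := (n7_124Table K).Alg

variable (L : Type*) [LieRing L] [LieAlgebra K L]

/-- `L` is isomorphic to one of the five direct products `n_7^124 ⊕ K`, `n_6^19 ⊕ K^2`,
`n_6^20 ⊕ K^2`, `n_5^5 ⊕ K^3`, `n_3^1 ⊕ n_3^1 ⊕ K^2`. -/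
def IsInCommonList : Prop :=
  Nonempty (L ≃ₗ⁅K⁆ N7_124 K × Ab K 1) ∨
  Nonempty (L ≃ₗ⁅K⁆ N6_19 K × Ab K 2) ∨
  Nonempty (L ≃ₗ⁅K⁆ N6_20 K × Ab K 2) ∨
  Nonempty (L ≃ₗ⁅K⁆ N5_5 K × Ab K 3) ∨
  Nonempty (L ≃ₗ⁅K⁆ N3_1 K × N3_1 K × Ab K 2)

end Models

end SympLie

/-!
Since `L` is 2-step nilpotent, `(ad x)² = 0`, so the Jordan type of `ad x` is `(2^r, 1^m)` with
`r = rank (ad x)`, and the characteristic sequence `(2,2,1,1,1,1)` says that the greatest rank of an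
`ad x` is `2`. Comparing `ad x` with `ad (x + t y)` for all `t` leaves two cases: either the center
has codimension three and `L` is `n_6^20 ⊕ K^2`, or the derived algebra is a plane `⟨w₁, w₂⟩`.

In the second case put `eᵢ = θ(wᵢ, ·)`. Closedness of `θ` reads `ω₁ ∧ e₁ + ω₂ ∧ e₂ = 0` for the two
components `ωᵢ` of the bracket, so Cartan's lemma gives linear forms `a, b, d` with
`ω₁ = e₁ ∧ a + e₂ ∧ b` and `ω₂ = e₁ ∧ b + e₂ ∧ d`. Hence the center has codimension at most five. If
the five forms are independent, `L` is `n_7^124 ⊕ K`. Otherwise a change of the plane's basis acts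
on `(a, b, d)` as on a binary quadratic form and turns the linear relation into `d = μ a`; if
`e₁, e₂, a, b` are still dependent, `L` is `n_5^5 ⊕ K^3`, and if not, only the class of `μ` modulo
squares is left, which is what separates the real from the complex list.

In every case the center is larger than the derived algebra, and a central vector outside the
derived algebra splits off.
-/

namespace SympLie

section LinearAlgebra

open Module

variable {K V W : Type*} [Field K] [AddCommGroup V] [Module K V] [AddCommGroup W] [Module K W]
  {ι κ : Type*}

theorem exists_dual_family_of_linearIndependent [Finite ι] [DecidableEq ι] {w : ι → V}
    (hw : LinearIndependent K w) :
    ∃ ω : ι → Dual K V, ∀ i j, ω i (w j) = if i = j then 1 else 0 := by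
  have := Fintype.ofFinite ι
  obtain ⟨F, hF⟩ := (Fintype.linearCombination K w).exists_leftInverse_of_injective
    (LinearMap.ker_eq_bot.2 hw.fintypeLinearCombination_injective)
  refine ⟨fun i => LinearMap.proj i ∘ₗ F, fun i j => ?_⟩
  have hFw : F (w j) = Pi.single j 1 := by
    simpa [Fintype.linearCombination_apply_single] using
      LinearMap.congr_fun hF (Pi.single j (1 : K))
  simp [hFw, Pi.single_apply]

theorem eq_sum_smul_of_mem_span_of_dual [Fintype ι] [DecidableEq ι] {ω : ι → Dual K V} {w : ι → V}
    (hω : ∀ i j, ω i (w j) = if i = j then 1 else 0) {y : V}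
    (hy : y ∈ Submodule.span K (Set.range w)) : y = ∑ i, ω i y • w i := by
  obtain ⟨c, rfl⟩ := (Submodule.mem_span_range_iff_exists_fun K).1 hy
  simp only [map_sum, map_smul, hω, smul_eq_mul, mul_ite, mul_one, mul_zero, Finset.sum_ite_eq,
    Finset.mem_univ, if_true]

theorem card_le_finrank_of_forall_mem [FiniteDimensional K V] [Fintype ι] {S : Submodule K V}
    {w : ι → V} (hw : LinearIndependent K w) (hmem : ∀ i, w i ∈ S) :
    Fintype.card ι ≤ finrank K S := by
  rw [← finrank_span_eq_card hw]
  exact Submodule.finrank_mono (Submodule.span_le.2 (Set.range_subset_iff.2 hmem))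

theorem exists_dual_vectors_of_linearIndependent [FiniteDimensional K V] [Finite ι] [DecidableEq ι]
    {g : ι → Dual K V} (hg : LinearIndependent K g) :
    ∃ u : ι → V, ∀ i j, g i (u j) = if i = j then 1 else 0 := by
  obtain ⟨ω, hω⟩ := exists_dual_family_of_linearIndependent hg
  refine ⟨fun j => (evalEquiv K V).symm (ω j), fun i j => ?_⟩
  rw [apply_evalEquiv_symm_apply, hω, if_congr eq_comm rfl rfl]

theorem exists_apply_eq_of_dual [FiniteDimensional K V] [Finite ι] [Finite κ] [DecidableEq κ]
    {g : ι → Dual K V} {ω : κ → Dual K V} {w : κ → V} (hg : LinearIndependent K g)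
    (hω : ∀ i j, ω i (w j) = if i = j then 1 else 0) (hgw : ∀ i j, g i (w j) = 0)
    (c : ι → K) (d : κ → K) : ∃ x, (∀ i, g i x = c i) ∧ ∀ j, ω j x = d j := by
  classical
  have := Fintype.ofFinite ι
  have := Fintype.ofFinite κ
  obtain ⟨u, hu⟩ := exists_dual_vectors_of_linearIndependent hg
  refine ⟨∑ i, c i • u i + ∑ j, (d j - ω j (∑ i, c i • u i)) • w j, fun i => ?_, fun j => ?_⟩
  · simp [hu, hgw]
  · simp [hω]

theorem exists_ne_zero_linearIndependent_add_smul [Infinite K] [Finite ι] {p : ι → V}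
    (hp : LinearIndependent K p) (q : ι → V) :
    ∃ t : K, t ≠ 0 ∧ LinearIndependent K (p + t • q) := by
  classical
  have := Fintype.ofFinite ι
  obtain ⟨ω, hω⟩ := exists_dual_family_of_linearIndependent hp
  let N : Matrix ι ι K := Matrix.of fun i j => ω i (q j)
  have hP : Polynomial.X * (-N).charpolyRev ≠ 0 := by
    refine mul_ne_zero Polynomial.X_ne_zero fun h => ?_
    simpa [h] using Matrix.eval_charpolyRev (M := -N)
  obtain ⟨t, ht⟩ : ∃ t, (Polynomial.X * (-N).charpolyRev).eval t ≠ 0 := by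
    contrapose! hP
    exact Polynomial.funext (by simpa using hP)
  rw [Polynomial.eval_mul, Polynomial.eval_X] at ht
  have hdet : (1 + t • N).det ≠ 0 := by
    convert right_ne_zero_of_mul ht
    rw [Matrix.charpolyRev, ← Polynomial.coe_evalRingHom, RingHom.map_det]
    congr 1
    ext i j
    simp [Matrix.one_apply, apply_ite, mul_comm t]
  refine ⟨t, left_ne_zero_of_mul ht, Fintype.linearIndependent_iff.2 fun c hc => ?_⟩
  refine congr_fun (Matrix.eq_zero_of_mulVec_eq_zero hdet (funext fun i => ?_))
  have hi := congrArg (ω i) hc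
  simp only [Pi.add_apply, Pi.smul_apply, map_sum, map_smul, map_add, map_zero, hω,
    smul_eq_mul] at hi
  simpa [Matrix.mulVec, dotProduct, N, Matrix.one_apply, mul_comm] using hi

theorem map_ker_le_range_of_finrank_range_add_smul_le [Infinite K] [FiniteDimensional K V]
    {f g : V →ₗ[K] W}
    (h : ∀ t : K, finrank K (LinearMap.range (f + t • g)) ≤ finrank K (LinearMap.range f)) :
    (LinearMap.ker f).map g ≤ LinearMap.range f := by
  rintro _ ⟨z, hz, rfl⟩
  by_contra hgz
  let b := finBasis K (LinearMap.range f)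
  choose u hu using fun i => (b i).2
  have hspan : Submodule.span K (Set.range (f ∘ u)) ≤ LinearMap.range f :=
    Submodule.span_le.2 <| Set.range_subset_iff.2 fun i => ⟨u i, rfl⟩
  have hfu : LinearIndependent K (f ∘ u) := by
    rw [show f ∘ u = (LinearMap.range f).subtype ∘ b from funext hu]
    exact b.linearIndependent.map' _ (Submodule.ker_subtype _)
  let p : Fin (finrank K (LinearMap.range f) + 1) → W := Fin.cons (g z) (f ∘ u)
  let q : Fin (finrank K (LinearMap.range f) + 1) → W := Fin.cons 0 (g ∘ u)
  have hp : LinearIndependent K p :=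
    linearIndependent_finCons.2 ⟨hfu, fun hmem => hgz (hspan hmem)⟩
  obtain ⟨t, ht, hind⟩ := exists_ne_zero_linearIndependent_add_smul hp q
  have hmem : ∀ i, (p + t • q) i ∈ LinearMap.range (f + t • g) := by
    refine Fin.cases ⟨t⁻¹ • z, ?_⟩ fun i => ⟨u i, by simp [p, q]⟩
    simp [p, q, LinearMap.mem_ker.1 hz, ht]
  have hcard := Submodule.finrank_mono (Submodule.span_le.2 (Set.range_subset_iff.2 hmem))
  rw [finrank_span_eq_card hind, Fintype.card_fin] at hcard
  have := h t
  omega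

theorem range_le_ker_of_forall_apply_apply_eq_zero {f : V →ₗ[K] V} (hf : ∀ x, f (f x) = 0) :
    LinearMap.range f ≤ LinearMap.ker f :=
  LinearMap.range_le_ker_iff.2 (LinearMap.ext hf)

theorem exists_basis_of_forall_apply_apply_eq_zero [FiniteDimensional K V] {f : V →ₗ[K] V}
    (hf : ∀ x, f (f x) = 0) {r m : ℕ} (hr : finrank K (LinearMap.range f) = r)
    (hV : finrank K V = 2 * r + m) :
    ∃ b : Basis ((Fin r ⊕ Fin m) ⊕ Fin r) K V,
      (∀ i, f (b (Sum.inl i)) = 0) ∧ ∀ i, f (b (Sum.inr i)) = b (Sum.inl (Sum.inl i)) := by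
  have hle := range_le_ker_of_forall_apply_apply_eq_zero hf
  let range := (LinearMap.range f).submoduleOf (LinearMap.ker f)
  let e := Submodule.submoduleOfEquivOfLe hle
  have hquot : finrank K (LinearMap.ker f ⧸ range) = m := by
    have h₁ := range.finrank_quotient_add_finrank
    have h₂ := f.finrank_range_add_finrank_ker
    rw [e.finrank_eq] at h₁
    omega
  let c := finBasisOfFinrankEq K (LinearMap.range f) hr
  let b := ((c.map e.symm).sumQuot (finBasisOfFinrankEq K _ hquot)).sumQuot
    (c.map f.quotKerEquivRange.symm)
  refine ⟨b, fun i => ?_, fun i => ?_⟩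
  · rw [Basis.sumQuot_inl]
    exact LinearMap.mem_ker.1 (Subtype.property _)
  · have h : f (b (Sum.inr i)) = f.quotKerEquivRange (Submodule.Quotient.mk (b (Sum.inr i))) := rfl
    rw [h, Basis.sumQuot_inr, Basis.map_apply, LinearEquiv.apply_symm_apply, Basis.sumQuot_inl,
      Basis.sumQuot_inl, Basis.map_apply]
    rfl

/-- The alternating bilinear form `f ∧ g`. -/
def wedge (f g : Dual K V) (x y : V) : K := f x * g y - g x * f y

theorem linearIndependent_pair_of_wedge_ne_zero {f g : Dual K V} {x y : V}
    (h : wedge f g x y ≠ 0) : LinearIndependent K ![x, y] := by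
  refine LinearIndependent.pair_iff.2 fun s t hst => ?_
  have hf : s * f x + t * f y = 0 := by simpa using congrArg f hst
  have hg : s * g x + t * g y = 0 := by simpa using congrArg g hst
  have hs : s * wedge f g x y = 0 := by
    unfold wedge
    linear_combination g y * hf - f y * hg
  have ht : t * wedge f g x y = 0 := by
    unfold wedge
    linear_combination f x * hg - g x * hf
  exact ⟨(mul_eq_zero.1 hs).resolve_right h, (mul_eq_zero.1 ht).resolve_right h⟩

/-- Cartan's lemma for a pair of `2`-forms: the coefficient `b` is shared by `α` and `β`. -/
theorem exists_wedge_eq_of_closed [FiniteDimensional K V] {α β : LinearMap.BilinForm K V}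
    (hα : α.IsAlt) (hβ : β.IsAlt) {e₁ e₂ : Dual K V} (he : LinearIndependent K ![e₁, e₂])
    (hclosed : ∀ x y z, (α x y * e₁ z + β x y * e₂ z) + (α y z * e₁ x + β y z * e₂ x) +
      (α z x * e₁ y + β z x * e₂ y) = 0) :
    ∃ a b d : Dual K V, (∀ x y, α x y = wedge e₁ a x y + wedge e₂ b x y) ∧
      (∀ x y, β x y = wedge e₁ b x y + wedge e₂ d x y) ∧
      ∀ w, e₁ w = 0 → (∀ x, α x w = 0) → (∀ x, β x w = 0) → a w = 0 ∧ b w = 0 ∧ d w = 0 := by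
  obtain ⟨u, hu⟩ := exists_dual_vectors_of_linearIndependent he
  have h₁₀ : e₁ (u 0) = 1 := hu 0 0
  have h₁₁ : e₁ (u 1) = 0 := hu 0 1
  have h₂₀ : e₂ (u 0) = 0 := hu 1 0
  have h₂₁ : e₂ (u 1) = 1 := hu 1 1
  refine ⟨α (u 0), α (u 1) + α (u 0) (u 1) • e₁, β (u 1), fun x y => ?_, fun x y => ?_,
    fun w hw hαw hβw => by simp [hw, hαw, hβw]⟩
  · have hxy := hclosed x y (u 0)
    have hx := hclosed (u 0) (u 1) x
    have hy := hclosed (u 0) (u 1) y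
    simp only [h₁₀, h₁₁, h₂₀, h₂₁, ← hα.neg_eq (u 0) x, ← hα.neg_eq (u 0) y, ← hβ.neg_eq (u 0) x,
      ← hβ.neg_eq (u 0) y] at hxy hx hy
    simp only [wedge, LinearMap.add_apply, LinearMap.smul_apply, smul_eq_mul]
    linear_combination hxy - e₂ x * hy + e₂ y * hx
  · have hxy := hclosed x y (u 1)
    simp only [h₁₁, h₂₁, ← hα.neg_eq (u 1) y, ← hβ.neg_eq (u 1) y] at hxy
    simp only [wedge, LinearMap.add_apply, LinearMap.smul_apply, smul_eq_mul]
    linear_combination hxy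

end LinearAlgebra

section JordanSequence

open Module List

theorem replicate_append_replicate_lt {p q r m : ℕ} (hpr : p < r) (h : 2 * p + q = 2 * r + m) :
    replicate p 2 ++ replicate q 1 < replicate r 2 ++ replicate m 1 := by
  obtain ⟨r, rfl⟩ := Nat.exists_eq_add_of_lt hpr
  obtain ⟨q, rfl⟩ := Nat.exists_eq_succ_of_ne_zero (show q ≠ 0 by omega)
  rw [add_assoc, replicate_add, append_assoc, replicate_succ, replicate_succ, cons_append]
  exact append_left_lt (cons_lt_cons_iff.2 (Or.inl one_lt_two))

theorem replicate_append_replicate_le_iff {p q r m : ℕ} (h : 2 * p + q = 2 * r + m) :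
    replicate p 2 ++ replicate q 1 ≤ replicate r 2 ++ replicate m 1 ↔ p ≤ r := by
  refine ⟨fun hle => ?_, fun hle => ?_⟩
  · by_contra! hrp
    exact (replicate_append_replicate_lt hrp h.symm).not_ge hle
  · rcases hle.lt_or_eq with hlt | rfl
    · exact (replicate_append_replicate_lt hlt h).le
    · rw [Nat.add_left_cancel h]

theorem exists_eq_replicate_append_replicate {s : List ℕ} (hs : s.Pairwise (· ≥ ·))
    (hpos : ∀ m ∈ s, 0 < m) (hle : ∀ m ∈ s, m ≤ 2) :
    ∃ p q, s = replicate p 2 ++ replicate q 1 := by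
  induction s with
  | nil => exact ⟨0, 0, rfl⟩
  | cons a s ih =>
    rw [pairwise_cons] at hs
    rw [forall_mem_cons] at hpos hle
    obtain ⟨p, q, rfl⟩ := ih hs.2 hpos.2 hle.2
    obtain rfl | rfl : a = 2 ∨ a = 1 := by omega
    · exact ⟨p + 1, q, by rw [replicate_succ, cons_append]⟩
    · obtain rfl : p = 0 := by
        by_contra hp
        exact absurd (hs.1 2 (by simp [hp])) (by norm_num)
      exact ⟨0, q + 1, by simp [replicate_succ]⟩

variable {K V : Type*} [Field K] [AddCommGroup V] [Module K V] {f : V →ₗ[K] V} {s : List ℕ}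

theorem IsJordanSequence.sum_eq_finrank (h : IsJordanSequence f s) : s.sum = finrank K V := by
  obtain ⟨-, -, b, -⟩ := h
  rw [finrank_eq_card_basis b, Fintype.card_sigma]
  simp only [Fintype.card_fin, get_eq_getElem, Fin.sum_univ_getElem]

theorem IsJordanSequence.finrank_range_eq_sum (h : IsJordanSequence f s) :
    finrank K (LinearMap.range f) = (s.map (· - 1)).sum := by
  obtain ⟨-, -, b, hb⟩ := h
  let φ : (Σ i : Fin s.length, Fin (s.get i - 1)) → Σ i : Fin s.length, Fin (s.get i) :=
    Sigma.map id fun i => Fin.castLE (Nat.sub_le _ _)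
  have hφ : Function.Injective φ :=
    Function.injective_id.sigma_map fun i => Fin.castLE_injective _
  have hspan : Submodule.span K (Set.range (b ∘ φ)) = LinearMap.range f := by
    apply le_antisymm
    · rw [Submodule.span_le, Set.range_subset_iff]
      rintro ⟨i, j, hj⟩
      exact ⟨_, (hb i j (by omega)).2 (by omega)⟩
    · rw [LinearMap.range_eq_map, ← b.span_eq, Submodule.map_span_le]
      rintro _ ⟨⟨i, j, hj⟩, rfl⟩
      rcases j with _ | j
      · rw [(hb i 0 hj).1 rfl]
        exact zero_mem _
      · rw [(hb i j (by omega)).2 hj]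
        exact Submodule.subset_span ⟨⟨i, ⟨j, by omega⟩⟩, rfl⟩
  rw [← hspan, finrank_span_eq_card (b.linearIndependent.comp φ hφ), Fintype.card_sigma]
  simpa only [Fintype.card_fin, get_eq_getElem] using Fin.sum_univ_fun_getElem s (· - 1)

theorem IsJordanSequence.le_two (h : IsJordanSequence f s) (hf : ∀ x, f (f x) = 0) :
    ∀ m ∈ s, m ≤ 2 := by
  obtain ⟨-, -, b, hb⟩ := h
  intro m hm
  obtain ⟨i, rfl⟩ := get_of_mem hm
  by_contra! hlt
  have h₁ := (hb i 1 (by omega)).2 hlt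
  have h₀ := (hb i 0 (by omega)).2 (by omega)
  exact b.ne_zero _ (by rw [← h₀, ← h₁, hf])

theorem exists_equiv_sigma_fin_get_replicate_append_replicate (r m : ℕ) {s : List ℕ}
    (hs : s = replicate r 2 ++ replicate m 1) :
    ∃ φ : (Σ i : Fin s.length, Fin (s.get i)) ≃ (Fin r ⊕ Fin m) ⊕ Fin r,
      (∀ i (h : 0 < s.get i), ∃ k, φ ⟨i, ⟨0, h⟩⟩ = Sum.inl k) ∧
      ∀ i (h : 1 < s.get i), ∃ k, φ ⟨i, ⟨1, h⟩⟩ = Sum.inr k ∧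
        φ ⟨i, ⟨0, h.trans' zero_lt_one⟩⟩ = Sum.inl (Sum.inl k) := by
  have hlen : s.length = r + m := by simp [hs]
  have hget : ∀ i : Fin s.length, s.get i = if i.val < r then 2 else 1 := fun i => by
    simp [hs, getElem_append]
  let φ : (Σ i : Fin s.length, Fin (s.get i)) → (Fin r ⊕ Fin m) ⊕ Fin r := fun k =>
    if h : k.1.val < r then
      if k.2.val = 0 then Sum.inl (Sum.inl ⟨k.1, h⟩) else Sum.inr ⟨k.1, h⟩
    else Sum.inl (Sum.inr ⟨k.1 - r, by omega⟩)
  have hφ : Function.Bijective φ := by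
    refine (Fintype.bijective_iff_injective_and_card φ).2 ⟨?_, ?_⟩
    · rintro ⟨i, j, hj⟩ ⟨i', j', hj'⟩ h
      obtain ⟨hii, hjj⟩ : i.val = i'.val ∧ j = j' := by
        rw [hget] at hj hj'
        simp only [φ] at h
        split_ifs at h hj hj' <;> simp only [Sum.inl.injEq, Sum.inr.injEq, Fin.mk.injEq,
          reduceCtorEq] at h <;> omega
      obtain rfl := Fin.ext hii
      subst hjj
      rfl
    · have hsum : s.sum = 2 * r + m := by simp [hs, mul_comm]
      simp only [Fintype.card_sigma, Fintype.card_fin, get_eq_getElem, Fin.sum_univ_getElem,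
        Fintype.card_sum, hsum]
      omega
  refine ⟨Equiv.ofBijective φ hφ, fun i h => ?_, fun i h => ?_⟩
  · by_cases hi : i.val < r <;> simp [φ, hi]
  · have hi : i.val < r := by
      by_contra hi
      have := hget i
      rw [if_neg hi] at this
      omega
    simp [φ, hi]

variable [FiniteDimensional K V]

theorem isJordanSequence_replicate_append_replicate (hf : ∀ x, f (f x) = 0) {r m : ℕ}
    (hr : finrank K (LinearMap.range f) = r) (hV : finrank K V = 2 * r + m) :
    IsJordanSequence f (replicate r 2 ++ replicate m 1) := by
  obtain ⟨b, hb₀, hb₁⟩ := exists_basis_of_forall_apply_apply_eq_zero hf hr hV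
  obtain ⟨φ, hφ₀, hφ₁⟩ := exists_equiv_sigma_fin_get_replicate_append_replicate r m rfl
  have hle : ∀ k ∈ replicate r 2 ++ replicate m 1, k ≤ 2 := by
    simp +contextual [or_imp]
  refine ⟨by simp [pairwise_append], by simp +contextual [or_imp], b.reindex φ.symm,
    fun i j hj => ⟨?_, fun hj' => ?_⟩⟩
  · rintro rfl
    obtain ⟨k, hk⟩ := hφ₀ i hj
    rw [Basis.reindex_apply, Equiv.symm_symm, hk, hb₀]
  · obtain rfl : j = 0 := by
      have := hle _ (get_mem _ i)
      omega
    obtain ⟨k, hk₁, hk₀⟩ := hφ₁ i hj'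
    rw [Basis.reindex_apply, Basis.reindex_apply, Equiv.symm_symm, hk₁, hk₀, hb₁]

theorem isJordanSequence_iff (hf : ∀ x, f (f x) = 0) :
    IsJordanSequence f s ↔ ∃ m, finrank K V = 2 * finrank K (LinearMap.range f) + m ∧
      s = replicate (finrank K (LinearMap.range f)) 2 ++ replicate m 1 := by
  refine ⟨fun h => ?_, ?_⟩
  · obtain ⟨p, q, rfl⟩ := exists_eq_replicate_append_replicate h.1 h.2.1 (h.le_two hf)
    have hp : finrank K (LinearMap.range f) = p := by simpa using h.finrank_range_eq_sum
    refine ⟨q, ?_, by rw [hp]⟩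
    simpa [hp, mul_comm, eq_comm] using h.sum_eq_finrank
  · rintro ⟨m, hV, rfl⟩
    exact isJordanSequence_replicate_append_replicate hf rfl hV

end JordanSequence

section Breadth

open Module List
open LieAlgebra (ad center)
open LieModule (lowerCentralSeries)

variable {K L : Type*} [Field K] [LieRing L] [LieAlgebra K L]

theorem lie_mem_lowerCentralSeries_one (x y : L) : ⁅x, y⁆ ∈ lowerCentralSeries K L L 1 :=
  LieSubmodule.lie_mem_lie (LieSubmodule.mem_top x) (LieSubmodule.mem_top y)

theorem lowerCentralSeries_one_le_iff {S : Submodule K L} :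
    (lowerCentralSeries K L L 1).toSubmodule ≤ S ↔ ∀ x y : L, ⁅x, y⁆ ∈ S := by
  refine ⟨fun h x y => h (lie_mem_lowerCentralSeries_one x y), fun h => ?_⟩
  rw [LieModule.lowerCentralSeries_succ, LieSubmodule.lieIdeal_oper_eq_linear_span',
    Submodule.span_le]
  rintro _ ⟨x, -, y, -, rfl⟩
  exact h x y

theorem lowerCentralSeries_one_le_center_iff :
    lowerCentralSeries K L L 1 ≤ center K L ↔ ∀ x y z : L, ⁅x, ⁅y, z⁆⁆ = 0 := by
  rw [← LieSubmodule.toSubmodule_le_toSubmodule, lowerCentralSeries_one_le_iff]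
  exact ⟨fun h x y z => h y z x, fun h y z x => h x y z⟩

theorem lowerCentralSeries_two_eq_bot_iff :
    lowerCentralSeries K L L 2 = ⊥ ↔ lowerCentralSeries K L L 1 ≤ center K L := by
  rw [LieModule.lowerCentralSeries_succ, ← LieModule.le_max_triv_iff_bracket_eq_bot]

theorem ad_eq_zero_of_mem_center {x : L} (hx : x ∈ center K L) : ad K L x = 0 := by
  ext y
  rw [LieAlgebra.ad_apply, ← lie_skew, hx y, neg_zero, LinearMap.zero_apply]

theorem finrank_range_ad_of_mem_center {x : L} (hx : x ∈ center K L) :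
    finrank K (LinearMap.range (ad K L x)) = 0 := by
  rw [ad_eq_zero_of_mem_center hx, LinearMap.range_zero, finrank_bot]

variable (K L) in
/-- `L` has breadth `r`: the greatest rank of an adjoint map `ad x` is `r`. -/
def HasBreadth (r : ℕ) : Prop :=
  IsGreatest (Set.range fun x : L => finrank K (LinearMap.range (ad K L x))) r

theorem HasBreadth.finrank_range_ad_le {r : ℕ} (h : HasBreadth K L r) (x : L) :
    finrank K (LinearMap.range (ad K L x)) ≤ r :=
  h.2 ⟨x, rfl⟩

theorem HasBreadth.exists_lie_ne_zero {r : ℕ} (h : HasBreadth K L r) (hr : 0 < r) :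
    ∃ x y : L, ⁅x, y⁆ ≠ 0 := by
  obtain ⟨x, hx⟩ := h.1
  by_contra! h₀
  exact hr.ne' (hx.symm.trans (finrank_range_ad_of_mem_center fun y => h₀ y x))

theorem isCharSequence_iff_hasBreadth (h : lowerCentralSeries K L L 1 ≤ center K L) {r m : ℕ}
    (hL : finrank K L = 2 * r + m) (hr : 0 < r) :
    IsCharSequence K L (replicate r 2 ++ replicate m 1) ↔ HasBreadth K L r := by
  have : FiniteDimensional K L := FiniteDimensional.of_finrank_pos (by omega)
  have hsq : ∀ x y : L, ad K L x (ad K L x y) = 0 := fun x =>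
    lowerCentralSeries_one_le_center_iff.1 h x x
  have hiff : ∀ (x : L) (s : List ℕ), IsJordanSequence (ad K L x) s ↔
      ∃ q, finrank K L = 2 * finrank K (LinearMap.range (ad K L x)) + q ∧
        s = replicate (finrank K (LinearMap.range (ad K L x))) 2 ++ replicate q 1 := fun x s =>
    isJordanSequence_iff (hsq x)
  constructor
  · rintro ⟨⟨x, -, hx⟩, hmax⟩
    refine ⟨⟨x, by simpa using hx.finrank_range_eq_sum⟩, ?_⟩
    rintro _ ⟨y, rfl⟩
    by_cases hy : y ∈ lowerCentralSeries K L L 1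
    · exact (finrank_range_ad_of_mem_center (h hy)).trans_le r.zero_le
    · have hle : 2 * finrank K (LinearMap.range (ad K L y)) ≤ finrank K L := by
        have h₁ := Submodule.finrank_mono (range_le_ker_of_forall_apply_apply_eq_zero (hsq y))
        have h₂ := (ad K L y).finrank_range_add_finrank_ker
        omega
      obtain ⟨q, hq⟩ := Nat.exists_eq_add_of_le hle
      exact (replicate_append_replicate_le_iff (hq.symm.trans hL)).1
        (hmax ⟨y, hy, (hiff y _).2 ⟨q, hq, rfl⟩⟩)
  · rintro ⟨⟨x, hx⟩, hmax⟩
    refine ⟨⟨x, fun hmem => ?_, (hiff x _).2 ⟨m, ?_, ?_⟩⟩, ?_⟩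
    · exact hr.ne' (hx.symm.trans (finrank_range_ad_of_mem_center (h hmem)))
    · exact hL.trans (by rw [← hx])
    · rw [← hx]
    · rintro s ⟨y, -, hy⟩
      obtain ⟨q, hq, rfl⟩ := (hiff y s).1 hy
      exact (replicate_append_replicate_le_iff (hq.symm.trans hL)).2 (hmax ⟨y, rfl⟩)

variable (K L) in
theorem isSymplecticOfType221111_iff :
    IsSymplecticOfType221111 K L ↔ finrank K L = 8 ∧
      lowerCentralSeries K L L 1 ≤ center K L ∧ IsSymplectic K L ∧ HasBreadth K L 2 := by
  unfold IsSymplecticOfType221111 IsTwoStepNilpotent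
  rw [lowerCentralSeries_two_eq_bot_iff]
  constructor
  · rintro ⟨hL, ⟨h, -⟩, hs, hc⟩
    exact ⟨hL, h, hs, (isCharSequence_iff_hasBreadth h (r := 2) (m := 4) hL two_pos).1 hc⟩
  · rintro ⟨hL, h, hs, hb⟩
    refine ⟨hL, ⟨h, fun hbot => ?_⟩, hs,
      (isCharSequence_iff_hasBreadth h (r := 2) (m := 4) hL two_pos).2 hb⟩
    obtain ⟨x, y, hxy⟩ := hb.exists_lie_ne_zero two_pos
    have := lie_mem_lowerCentralSeries_one (K := K) x y
    rw [hbot] at this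
    exact hxy this

end Breadth

section Transport

open Module
open LieAlgebra (ad center)
open LieModule (lowerCentralSeries)

variable {K L M : Type*} [Field K] [LieRing L] [LieAlgebra K L] [LieRing M] [LieAlgebra K M]

theorem IsSymplectic.of_equiv (e : L ≃ₗ⁅K⁆ M) (h : IsSymplectic K M) : IsSymplectic K L := by
  obtain ⟨θ, halt, hnd, hclosed⟩ := h
  refine ⟨LinearMap.BilinForm.congr e.symm.toLinearEquiv θ, fun x => halt (e x), hnd.congr _,
    fun x y z => ?_⟩
  have h : θ (e ⁅x, y⁆) (e z) + θ (e ⁅y, z⁆) (e x) + θ (e ⁅z, x⁆) (e y) = 0 := by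
    simpa only [LieEquiv.map_lie] using hclosed (e x) (e y) (e z)
  exact h

theorem finrank_range_ad_equiv (e : L ≃ₗ⁅K⁆ M) (x : L) :
    finrank K (LinearMap.range (ad K M (e x))) = finrank K (LinearMap.range (ad K L x)) := by
  have h : ad K M (e x) ∘ₗ e.toLinearEquiv = e.toLinearEquiv ∘ₗ ad K L x :=
    LinearMap.ext fun y => (e.map_lie x y).symm
  rw [← LinearEquiv.range_comp e.toLinearEquiv (ad K M (e x)), h, LinearMap.range_comp,
    LinearEquiv.finrank_map_eq]

theorem HasBreadth.of_equiv (e : L ≃ₗ⁅K⁆ M) {r : ℕ} (h : HasBreadth K M r) :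
    HasBreadth K L r := by
  obtain ⟨⟨y, hy⟩, hle⟩ := h
  refine ⟨⟨e.symm y, (finrank_range_ad_equiv e.symm y).trans hy⟩, ?_⟩
  rintro _ ⟨x, rfl⟩
  exact hle ⟨e x, finrank_range_ad_equiv e x⟩

theorem IsSymplecticOfType221111.of_equiv (e : L ≃ₗ⁅K⁆ M) (h : IsSymplecticOfType221111 K M) :
    IsSymplecticOfType221111 K L := by
  rw [isSymplecticOfType221111_iff, lowerCentralSeries_one_le_center_iff] at h ⊢
  obtain ⟨hM, hnil, hs, hb⟩ := h
  refine ⟨e.toLinearEquiv.finrank_eq.trans hM, fun x y z => ?_, hs.of_equiv e, hb.of_equiv e⟩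
  rw [← e.symm_apply_apply ⁅x, ⁅y, z⁆⁆, e.map_lie, e.map_lie, hnil, map_zero]

end Transport

section BreadthTwo

open Module Submodule
open LieAlgebra (ad center)

variable {K L : Type*} [Field K] [LieRing L] [LieAlgebra K L]

theorem HasBreadth.lie_mem_range_ad [Infinite K] [FiniteDimensional K L] {r : ℕ}
    (h : HasBreadth K L r) {x : L} (hx : finrank K (LinearMap.range (ad K L x)) = r) {z : L}
    (hz : ⁅x, z⁆ = 0) (y : L) : ⁅y, z⁆ ∈ LinearMap.range (ad K L x) := by
  refine map_ker_le_range_of_finrank_range_add_smul_le (f := ad K L x) (g := ad K L y)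
    (fun t => ?_) (mem_map_of_mem (f := ad K L y) (LinearMap.mem_ker.2 hz))
  rw [hx, ← map_smul, ← map_add]
  exact h.finrank_range_ad_le _

theorem HasBreadth.range_ad_eq_span [FiniteDimensional K L] (h : HasBreadth K L 2) {x u v : L}
    (huv : LinearIndependent K ![⁅x, u⁆, ⁅x, v⁆]) :
    LinearMap.range (ad K L x) = span K {⁅x, u⁆, ⁅x, v⁆} := by
  have hle : span K {⁅x, u⁆, ⁅x, v⁆} ≤ LinearMap.range (ad K L x) :=
    span_le.2 (Set.pair_subset ⟨u, rfl⟩ ⟨v, rfl⟩)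
  refine (eq_of_le_of_finrank_le hle ?_).symm
  have hcard := finrank_span_eq_card huv
  rw [Matrix.range_cons_cons_empty, Fintype.card_fin] at hcard
  exact (h.finrank_range_ad_le x).trans hcard.ge

theorem HasBreadth.exists_linearIndependent_lie [FiniteDimensional K L] (h : HasBreadth K L 2) :
    ∃ x u v : L, LinearIndependent K ![⁅x, u⁆, ⁅x, v⁆] := by
  obtain ⟨x, hx⟩ := h.1
  let B := finBasisOfFinrankEq K _ hx
  obtain ⟨u, hu⟩ := (B 0).2
  obtain ⟨v, hv⟩ := (B 1).2
  refine ⟨x, u, v, ?_⟩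
  have hB : (LinearMap.range (ad K L x)).subtype ∘ B = ![⁅x, u⁆, ⁅x, v⁆] := by
    ext i
    fin_cases i
    exacts [hu.symm, hv.symm]
  exact hB ▸ B.linearIndependent.map' _ (ker_subtype _)

theorem HasBreadth.lie_mem_span_of_lie_eq_zero [Infinite K] [FiniteDimensional K L]
    (h : HasBreadth K L 2) {x u v z : L} (huv : LinearIndependent K ![⁅x, u⁆, ⁅x, v⁆])
    (hz : ⁅x, z⁆ = 0) (y : L) : ⁅y, z⁆ ∈ span K {⁅x, u⁆, ⁅x, v⁆} := by
  have hcard : 2 ≤ finrank K (LinearMap.range (ad K L x)) :=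
    card_le_finrank_of_forall_mem huv (Fin.forall_fin_two.2 ⟨⟨u, rfl⟩, ⟨v, rfl⟩⟩)
  rw [← h.range_ad_eq_span huv]
  exact h.lie_mem_range_ad ((h.finrank_range_ad_le x).antisymm hcard) hz y

theorem HasBreadth.exists_eq_add_of_lie_eq_zero [FiniteDimensional K L] (h : HasBreadth K L 2)
    {x u v : L} (huv : LinearIndependent K ![⁅x, u⁆, ⁅x, v⁆]) (y : L) :
    ∃ (s t : K) (z : L), ⁅x, z⁆ = 0 ∧ y = s • u + t • v + z := by
  have hy : ⁅x, y⁆ ∈ LinearMap.range (ad K L x) := ⟨y, rfl⟩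
  rw [h.range_ad_eq_span huv, mem_span_pair] at hy
  obtain ⟨s, t, hst⟩ := hy
  exact ⟨s, t, y - (s • u + t • v), by rw [lie_sub, lie_add, lie_smul, lie_smul, hst, sub_self],
    by abel⟩

theorem HasBreadth.lie_mem_span_of_lie_mem_span [Infinite K] [FiniteDimensional K L]
    (h : HasBreadth K L 2) {x u v : L} (huv : LinearIndependent K ![⁅x, u⁆, ⁅x, v⁆])
    (hmem : ⁅u, v⁆ ∈ span K {⁅x, u⁆, ⁅x, v⁆}) (y z : L) : ⁅y, z⁆ ∈ span K {⁅x, u⁆, ⁅x, v⁆} := by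
  set S := span K {⁅x, u⁆, ⁅x, v⁆}
  obtain ⟨s, t, y, hy, rfl⟩ := h.exists_eq_add_of_lie_eq_zero huv y
  obtain ⟨s', t', z, hz, rfl⟩ := h.exists_eq_add_of_lie_eq_zero huv z
  have hker : ∀ a b : L, ⁅x, b⁆ = 0 → ⁅a, b⁆ ∈ S := fun a b hb =>
    h.lie_mem_span_of_lie_eq_zero huv hb a
  have hplane : ⁅s • u + t • v, s' • u + t' • v⁆ = (s * t' - t * s') • ⁅u, v⁆ := by
    simp only [lie_add, add_lie, lie_smul, smul_lie, lie_self, ← lie_skew v u]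
    module
  rw [lie_add, add_lie, hplane, ← lie_skew y]
  exact S.add_mem (S.add_mem (S.smul_mem _ hmem) (S.neg_mem (hker _ _ hy))) (hker _ _ hz)

theorem HasBreadth.apply_lie_eq_zero [FiniteDimensional K L] (h : HasBreadth K L 2) {x u v : L}
    (huv : LinearIndependent K ![⁅x, u⁆, ⁅x, v⁆]) {φ : Dual K L} (hu : φ ⁅x, u⁆ = 0)
    (hv : φ ⁅x, v⁆ = 0) (y : L) : φ ⁅x, y⁆ = 0 := by
  obtain ⟨s, t, z, hz, rfl⟩ := h.exists_eq_add_of_lie_eq_zero huv y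
  simp only [lie_add, lie_smul, map_add, map_smul, hu, hv, hz, smul_zero, add_zero]

theorem HasBreadth.apply_lie_eq_zero_of_lie_eq_zero [Infinite K] [FiniteDimensional K L]
    (h : HasBreadth K L 2) {x u v z : L} (huv : LinearIndependent K ![⁅x, u⁆, ⁅x, v⁆])
    {φ : Dual K L} (hu : φ ⁅x, u⁆ = 0) (hv : φ ⁅x, v⁆ = 0) (hz : ⁅x, z⁆ = 0) (y : L) :
    φ ⁅y, z⁆ = 0 := by
  obtain ⟨s, t, hst⟩ := mem_span_pair.1 (h.lie_mem_span_of_lie_eq_zero huv hz y)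
  rw [← hst, map_add, map_smul, map_smul, hu, hv, smul_zero, smul_zero, add_zero]

theorem linearIndependent_lie_pairs {x u v : L}
    (huv : LinearIndependent K ![⁅x, u⁆, ⁅x, v⁆, ⁅u, v⁆]) :
    LinearIndependent K ![⁅x, u⁆, ⁅x, v⁆] ∧ LinearIndependent K ![⁅u, x⁆, ⁅u, v⁆] ∧
      LinearIndependent K ![⁅v, x⁆, ⁅v, u⁆] ∧
      LinearIndependent K ![⁅u + v, x⁆, ⁅u + v, v⁆] := by
  obtain ⟨ω, hω⟩ := exists_dual_family_of_linearIndependent huv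
  have hxu : ∀ i, ω i ⁅x, u⁆ = if i = 0 then 1 else 0 := fun i => hω i 0
  have hxv : ∀ i, ω i ⁅x, v⁆ = if i = 1 then 1 else 0 := fun i => hω i 1
  have huv : ∀ i, ω i ⁅u, v⁆ = if i = 2 then 1 else 0 := fun i => hω i 2
  have hskew : ∀ (i) (a b : L), ω i ⁅a, b⁆ = -ω i ⁅b, a⁆ := fun i a b => by
    rw [← lie_skew, map_neg]
  refine ⟨linearIndependent_pair_of_wedge_ne_zero (f := ω 0) (g := ω 1) ?_,
    linearIndependent_pair_of_wedge_ne_zero (f := ω 0) (g := ω 2) ?_,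
    linearIndependent_pair_of_wedge_ne_zero (f := ω 1) (g := ω 2) ?_,
    linearIndependent_pair_of_wedge_ne_zero (f := ω 0) (g := ω 2) ?_⟩ <;>
  simp [wedge, hskew _ u x, hskew _ v x, hskew _ v u, hxu, hxv, huv]

theorem HasBreadth.exists_lie_eq_smul_lie [Infinite K] [FiniteDimensional K L]
    (h : HasBreadth K L 2) {x u v z : L}
    (huv : LinearIndependent K ![⁅x, u⁆, ⁅x, v⁆, ⁅u, v⁆]) (hz : ⁅x, z⁆ = 0) :
    ∃ c : K, ⁅u, z⁆ = c • ⁅x, u⁆ ∧ ⁅v, z⁆ = c • ⁅x, v⁆ := by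
  obtain ⟨ω, hω⟩ := exists_dual_family_of_linearIndependent huv
  obtain ⟨hx, hu, hv, hdiag⟩ := linearIndependent_lie_pairs huv
  have hxu : ∀ i, ω i ⁅x, u⁆ = if i = 0 then 1 else 0 := fun i => hω i 0
  have hxv : ∀ i, ω i ⁅x, v⁆ = if i = 1 then 1 else 0 := fun i => hω i 1
  have huv : ∀ i, ω i ⁅u, v⁆ = if i = 2 then 1 else 0 := fun i => hω i 2
  have hskew : ∀ (i) (a b : L), ω i ⁅a, b⁆ = -ω i ⁅b, a⁆ := fun i a b => by
    rw [← lie_skew, map_neg]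
  obtain ⟨a, b, hab⟩ := mem_span_pair.1 (h.lie_mem_span_of_lie_eq_zero hx hz u)
  obtain ⟨c, d, hcd⟩ := mem_span_pair.1 (h.lie_mem_span_of_lie_eq_zero hx hz v)
  have hb : b = 0 := by
    have hu₁ : ω 1 ⁅u, z⁆ = 0 :=
      h.apply_lie_eq_zero hu (by simp [hskew _ u x, hxu]) (by simp [huv]) z
    simpa [← hab, hxu, hxv] using hu₁
  have hc : c = 0 := by
    have hv₀ : ω 0 ⁅v, z⁆ = 0 :=
      h.apply_lie_eq_zero hv (by simp [hskew _ v x, hxv]) (by simp [hskew _ v u, huv]) z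
    simpa [← hcd, hxu, hxv] using hv₀
  have had : a - d = 0 := by
    have h₀₁ : (ω 0 - ω 1) ⁅u + v, z⁆ = 0 :=
      h.apply_lie_eq_zero hdiag (by simp [hskew _ u x, hskew _ v x, hxu, hxv]) (by simp [huv]) z
    simpa [← hab, ← hcd, hxu, hxv, hb, hc] using h₀₁
  obtain rfl := sub_eq_zero.1 had
  exact ⟨a, by simp [← hab, hb], by simp [← hcd, hc]⟩

theorem HasBreadth.mem_center_of_lie_eq_zero [Infinite K] [FiniteDimensional K L]
    (h : HasBreadth K L 2) {x u v z : L}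
    (huv : LinearIndependent K ![⁅x, u⁆, ⁅x, v⁆, ⁅u, v⁆]) (hx : ⁅x, z⁆ = 0) (hu : ⁅u, z⁆ = 0)
    (hv : ⁅v, z⁆ = 0) : z ∈ center K L := by
  intro y
  obtain ⟨ω, hω⟩ := exists_dual_family_of_linearIndependent huv
  obtain ⟨hxp, hup, hvp, -⟩ := linearIndependent_lie_pairs huv
  have hxu : ∀ i, ω i ⁅x, u⁆ = if i = 0 then 1 else 0 := fun i => hω i 0
  have hxv : ∀ i, ω i ⁅x, v⁆ = if i = 1 then 1 else 0 := fun i => hω i 1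
  have huv : ∀ i, ω i ⁅u, v⁆ = if i = 2 then 1 else 0 := fun i => hω i 2
  have hskew : ∀ (i) (a b : L), ω i ⁅a, b⁆ = -ω i ⁅b, a⁆ := fun i a b => by
    rw [← lie_skew, map_neg]
  obtain ⟨s, t, hst⟩ := mem_span_pair.1 (h.lie_mem_span_of_lie_eq_zero hxp hx y)
  have hs : s = 0 := by
    have h₀ : ω 0 ⁅y, z⁆ = 0 := h.apply_lie_eq_zero_of_lie_eq_zero hvp
      (by simp [hskew _ v x, hxv]) (by simp [hskew _ v u, huv]) hv y
    simpa [← hst, hxu, hxv] using h₀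
  have ht : t = 0 := by
    have h₁ : ω 1 ⁅y, z⁆ = 0 := h.apply_lie_eq_zero_of_lie_eq_zero hup
      (by simp [hskew _ u x, hxu]) (by simp [huv]) hu y
    simpa [← hst, hxu, hxv] using h₁
  rw [← hst, hs, ht, zero_smul, zero_smul, add_zero]

theorem HasBreadth.exists_add_smul_mem_center [Infinite K] [FiniteDimensional K L]
    (h : HasBreadth K L 2) {x u v z : L}
    (huv : LinearIndependent K ![⁅x, u⁆, ⁅x, v⁆, ⁅u, v⁆]) (hz : ⁅x, z⁆ = 0) :
    ∃ c : K, z + c • x ∈ center K L := by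
  obtain ⟨c, hu, hv⟩ := h.exists_lie_eq_smul_lie huv hz
  refine ⟨c, h.mem_center_of_lie_eq_zero huv ?_ ?_ ?_⟩
  · rw [lie_add, lie_smul, lie_self, hz, smul_zero, add_zero]
  · rw [lie_add, lie_smul, hu, ← lie_skew u x, smul_neg, add_neg_cancel]
  · rw [lie_add, lie_smul, hv, ← lie_skew v x, smul_neg, add_neg_cancel]

theorem HasBreadth.finrank_le_finrank_center_add_three [Infinite K] [FiniteDimensional K L]
    (h : HasBreadth K L 2) {x u v : L}
    (huv : LinearIndependent K ![⁅x, u⁆, ⁅x, v⁆, ⁅u, v⁆]) :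
    finrank K L ≤ finrank K (center K L) + 3 := by
  have hxuv := (linearIndependent_lie_pairs huv).1
  have htop : (⊤ : Submodule K L) ≤ (center K L).toSubmodule ⊔ span K (Set.range ![x, u, v]) := by
    intro y _
    obtain ⟨s, t, z, hz, rfl⟩ := h.exists_eq_add_of_lie_eq_zero hxuv y
    obtain ⟨c, hc⟩ := h.exists_add_smul_mem_center huv hz
    refine mem_sup.2 ⟨_, hc, -c • x + s • u + t • v, ?_, by module⟩
    have hmem : ∀ i, ![x, u, v] i ∈ span K (Set.range ![x, u, v]) := fun i =>
      subset_span ⟨i, rfl⟩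
    exact add_mem (add_mem (smul_mem _ _ (hmem 0)) (smul_mem _ _ (hmem 1))) (smul_mem _ _ (hmem 2))
  calc finrank K L = finrank K (⊤ : Submodule K L) := (finrank_top K L).symm
    _ ≤ finrank K ((center K L).toSubmodule ⊔ span K (Set.range ![x, u, v]) : Submodule K L) :=
      Submodule.finrank_mono htop
    _ ≤ finrank K (center K L) + finrank K (span K (Set.range ![x, u, v])) :=
      finrank_add_le_finrank_add_finrank _ _
    _ ≤ finrank K (center K L) + 3 := Nat.add_le_add_left (finrank_range_le_card _) _

end BreadthTwo

section Splitting

open Module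
open LieAlgebra (center)
open LieModule (lowerCentralSeries)

variable {K L M : Type*} [Field K] [LieRing L] [LieAlgebra K L] [LieRing M] [LieAlgebra K M]

namespace BracketTable

variable {n : ℕ} (D : BracketTable K n)

instance : FiniteDimensional K D.Alg := inferInstanceAs (FiniteDimensional K (Fin n → K))

theorem finrank_alg : finrank K D.Alg = n := finrank_fin_fun K

/-- The homomorphism to the Lie algebra of a bracket table whose coordinates are the functionals
`p i`. -/
def lift (p : Fin n → Dual K L)
    (hp : ∀ (x y : L) (i), p i ⁅x, y⁆ = D.br (fun j => p j x) (fun j => p j y) i) :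
    L →ₗ⁅K⁆ D.Alg where
  toLinearMap := LinearMap.pi p
  map_lie' {x y} := funext (hp x y)

end BracketTable

theorem nonempty_lieEquiv_prod_ab [FiniteDimensional K L] [FiniteDimensional K M] {m : ℕ}
    (π : L →ₗ⁅K⁆ M) (hπ : Function.Surjective π)
    (hker : ∀ w ∈ lowerCentralSeries K L L 1, π w = 0 → w = 0)
    (hL : finrank K L = finrank K M + m) : Nonempty (L ≃ₗ⁅K⁆ M × Ab K m) := by
  set N := LinearMap.ker (π : L →ₗ[K] M) with hN
  have hdisj : Disjoint (lowerCentralSeries K L L 1).toSubmodule N :=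
    Submodule.disjoint_def.2 hker
  obtain ⟨C, hC, hCN⟩ := hdisj.exists_isCompl
  have hm : finrank K N = m := by
    have hrank := (π : L →ₗ[K] M).finrank_range_add_finrank_ker
    rw [LinearMap.range_eq_top.2 hπ, finrank_top, ← hN] at hrank
    omega
  let ε : N ≃ₗ[K] (Fin m → K) := LinearEquiv.ofFinrankEq _ _ (by rw [hm, finrank_fin_fun])
  let q : L →ₗ[K] (Fin m → K) := ε ∘ₗ N.projectionOnto C hCN.symm
  have hq : ∀ x, q x = 0 ↔ x ∈ C := fun x => by simp [q]
  let F : L →ₗ⁅K⁆ M × Ab K m := π.prod ((abelianTable K m).lift (fun i => LinearMap.proj i ∘ₗ q)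
    fun x y => congrFun ((hq _).2 (hC (lie_mem_lowerCentralSeries_one x y))))
  have hF : Function.Injective F := (injective_iff_map_eq_zero F).2 fun x hx =>
    Submodule.disjoint_def.1 hCN.disjoint x ((hq x).1 (congrArg Prod.snd hx)) (congrArg Prod.fst hx)
  refine ⟨LieEquiv.ofBijective F ⟨hF, (LinearMap.injective_iff_surjective_of_finrank_eq_finrank
    (f := (F : L →ₗ[K] M × Ab K m)) ?_).1 hF⟩⟩
  rw [finrank_prod, BracketTable.finrank_alg, hL]

/-- The functionals `ω` are coordinates on the derived algebra, the functionals `g` on a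
complementary space, and `σ` lists both in the order of the table. -/
theorem nonempty_lieEquiv_alg_prod_ab [FiniteDimensional K L] {n m : ℕ} (D : BracketTable K n)
    {ι κ : Type*} [Finite ι] [Finite κ] [DecidableEq κ] {g : ι → Dual K L} {ω : κ → Dual K L}
    {w : κ → L} (hg : LinearIndependent K g) (hω : ∀ i j, ω i (w j) = if i = j then 1 else 0)
    (hgw : ∀ i j, g i (w j) = 0) (hw : ∀ x y : L, ⁅x, y⁆ ∈ Submodule.span K (Set.range w))
    {σ : Fin n → ι ⊕ κ} (hσ : Function.Bijective σ)
    (hbr : ∀ (x y : L) (i), Sum.elim g ω (σ i) ⁅x, y⁆ =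
      D.br (fun j => Sum.elim g ω (σ j) x) (fun j => Sum.elim g ω (σ j) y) i)
    (hL : finrank K L = n + m) : Nonempty (L ≃ₗ⁅K⁆ D.Alg × Ab K m) := by
  refine nonempty_lieEquiv_prod_ab (D.lift (Sum.elim g ω ∘ σ) hbr) (fun c => ?_)
    (fun y hy h => ?_) (by rwa [D.finrank_alg])
  · let τ := Equiv.ofBijective σ hσ
    obtain ⟨x, hx₁, hx₂⟩ := exists_apply_eq_of_dual hg hω hgw (fun i => c (τ.symm (.inl i)))
      fun j => c (τ.symm (.inr j))
    have hx : ∀ s, Sum.elim g ω s x = c (τ.symm s) := Sum.rec hx₁ hx₂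
    exact ⟨x, funext fun i => (hx (τ i)).trans (congrArg c (τ.symm_apply_apply i))⟩
  · have hωy : ∀ j, ω j y = 0 := fun j => by
      obtain ⟨i, hi⟩ := hσ.surjective (.inr j)
      have hpi : Sum.elim g ω (σ i) y = 0 := congrFun h i
      rwa [hi] at hpi
    have := Fintype.ofFinite κ
    rw [eq_sum_smul_of_mem_span_of_dual hω (lowerCentralSeries_one_le_iff.2 hw hy)]
    simp only [hωy, zero_smul, Finset.sum_const_zero]

theorem isDecomposable_of_not_center_le (h : ¬ center K L ≤ lowerCentralSeries K L L 1)
    (hab : ∃ x y : L, ⁅x, y⁆ ≠ 0) : IsDecomposable K L := by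
  obtain ⟨z, hz, hzS⟩ := SetLike.not_le_iff_exists.1 h
  have hz₀ : z ≠ 0 := fun h₀ => hzS (h₀ ▸ zero_mem _)
  obtain ⟨C, hC, hCz⟩ := ((Submodule.disjoint_span_singleton' hz₀).2 hzS).exists_isCompl
  let I : LieIdeal K L :=
    { Submodule.span K {z} with
      lie_mem := fun {x m} hm => by
        obtain ⟨c, rfl⟩ := Submodule.mem_span_singleton.1 hm
        rw [lie_smul, hz x, smul_zero]
        exact Submodule.zero_mem _ }
  let J : LieIdeal K L :=
    { C with lie_mem := fun {x m} _ => hC (lie_mem_lowerCentralSeries_one x m) }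
  have hzI : z ∈ I := Submodule.mem_span_singleton_self z
  refine ⟨I, J, fun hI => hz₀ ((LieSubmodule.mem_bot z).1 (hI ▸ hzI)), fun hJ => ?_,
    LieSubmodule.isCompl_toSubmodule.1 hCz.symm⟩
  obtain ⟨x, y, hxy⟩ := hab
  have hxyJ : ⁅x, y⁆ ∈ J := hC (lie_mem_lowerCentralSeries_one x y)
  exact hxy ((LieSubmodule.mem_bot _).1 (hJ ▸ hxyJ))

theorem isDecomposable_of_finrank_lt [FiniteDimensional K L]
    (h : finrank K (lowerCentralSeries K L L 1) < finrank K (center K L))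
    (hab : ∃ x y : L, ⁅x, y⁆ ≠ 0) : IsDecomposable K L :=
  isDecomposable_of_not_center_le (fun hle => h.not_ge (Submodule.finrank_mono hle)) hab

theorem finrank_le_finrank_center_add_finrank_span [FiniteDimensional K L] {ι : Type*}
    {φ : ι → Dual K L} (h : ∀ z, (∀ i, φ i z = 0) → z ∈ center K L) :
    finrank K L ≤ finrank K (center K L) + finrank K (Submodule.span K (Set.range φ)) := by
  have hle : (Submodule.span K (Set.range φ)).dualCoannihilator ≤ (center K L).toSubmodule :=
    fun z hz => h z fun i => (Submodule.mem_dualCoannihilator z).1 hz _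
      (Submodule.subset_span ⟨i, rfl⟩)
  have hmono := Submodule.finrank_mono hle
  have hsum := Subspace.finrank_add_finrank_dualCoannihilator_eq (Submodule.span K (Set.range φ))
  exact (hsum.symm.trans (add_comm _ _)).trans_le (Nat.add_le_add_right hmono _)

end Splitting

section CenterOfCodimensionThree

open Module
open LieAlgebra (center)
open LieModule (lowerCentralSeries)

variable {K L : Type*} [Field K] [LieRing L] [LieAlgebra K L]

theorem linearIndependent_mkQ_center {x u v : L} (huv : LinearIndependent K ![⁅x, u⁆, ⁅x, v⁆]) :
    LinearIndependent K ((center K L).toSubmodule.mkQ ∘ ![x, u, v]) := by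
  rw [Fintype.linearIndependent_iff]
  intro c hc
  have hz : c 0 • x + c 1 • u + c 2 • v ∈ (center K L).toSubmodule := by
    rw [← Submodule.ker_mkQ (center K L).toSubmodule, LinearMap.mem_ker]
    rw [map_add, map_add, map_smul, map_smul, map_smul]
    exact (Fin.sum_univ_three _).symm.trans hc
  obtain ⟨h₁, h₂⟩ := LinearIndependent.pair_iff.1 huv (c 1) (c 2) (by
    simpa only [lie_add, lie_smul, lie_self, smul_zero, zero_add] using hz x)
  have hux : c 0 • ⁅u, x⁆ = 0 := by
    simpa only [lie_add, lie_smul, h₁, h₂, zero_smul, add_zero] using hz u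
  have h₀ : c 0 = 0 := (smul_eq_zero.1 hux).resolve_right fun h =>
    huv.ne_zero 0 (by rw [Matrix.cons_val_zero, ← lie_skew, h, neg_zero])
  exact Fin.forall_fin_succ.2 ⟨h₀, Fin.forall_fin_two.2 ⟨h₁, h₂⟩⟩

theorem exists_coframe [FiniteDimensional K L] {x u v : L}
    (huv : LinearIndependent K ![⁅x, u⁆, ⁅x, v⁆])
    (hL : finrank K L ≤ finrank K (center K L) + 3) :
    ∃ φ : Fin 3 → Dual K L, LinearIndependent K φ ∧ (∀ z ∈ center K L, ∀ i, φ i z = 0) ∧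
      ∀ y, y - (φ 0 y • x + φ 1 y • u + φ 2 y • v) ∈ center K L := by
  have hind := linearIndependent_mkQ_center huv
  set Z := (center K L).toSubmodule
  have hQ : Fintype.card (Fin 3) = finrank K (L ⧸ Z) := by
    have hcard := hind.fintype_card_le_finrank
    have hsum := Z.finrank_quotient_add_finrank
    rw [Fintype.card_fin] at hcard ⊢
    change finrank K L ≤ finrank K Z + 3 at hL
    omega
  let B := basisOfLinearIndependentOfCardEqFinrank hind hQ
  refine ⟨fun i => B.coord i ∘ₗ Z.mkQ, ?_, fun z hz i => ?_, fun y => ?_⟩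
  · rw [← B.coe_dualBasis]
    exact B.dualBasis.linearIndependent.map' Z.mkQ.dualMap (LinearMap.ker_eq_bot.2
      (LinearMap.dualMap_injective_of_surjective Z.mkQ_surjective))
  · rw [LinearMap.comp_apply, LinearMap.mem_ker.1 (Z.ker_mkQ.ge hz), map_zero]
  · have hy := B.sum_repr (Z.mkQ y)
    rw [coe_basisOfLinearIndependentOfCardEqFinrank, Fin.sum_univ_three] at hy
    refine (Submodule.Quotient.eq Z).1 ?_
    exact hy.symm

theorem lie_eq_of_coframe {x u v : L} {φ : Fin 3 → Dual K L}
    (hφ : ∀ y, y - (φ 0 y • x + φ 1 y • u + φ 2 y • v) ∈ center K L) (y z : L) :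
    ⁅y, z⁆ = wedge (φ 0) (φ 1) y z • ⁅x, u⁆ + wedge (φ 0) (φ 2) y z • ⁅x, v⁆ +
      wedge (φ 1) (φ 2) y z • ⁅u, v⁆ := by
  have hz : ⁅y, z⁆ = ⁅y, φ 0 z • x + φ 1 z • u + φ 2 z • v⁆ := by
    rw [← sub_eq_zero, ← lie_sub, hφ z y]
  have hy : ∀ w : L, ⁅y, w⁆ = ⁅φ 0 y • x + φ 1 y • u + φ 2 y • v, w⁆ := fun w : L => by
    rw [← sub_eq_zero, ← sub_lie, ← lie_skew, hφ y w, neg_zero]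
  rw [hz, hy]
  simp only [wedge, lie_add, add_lie, lie_smul, smul_lie, lie_self]
  rw [← lie_skew x u, ← lie_skew x v, ← lie_skew u v]
  module

theorem nonempty_lieEquiv_n5_5 [FiniteDimensional K L] {m : ℕ} {x u v : L}
    (h : lowerCentralSeries K L L 1 ≤ center K L) (huv : LinearIndependent K ![⁅x, u⁆, ⁅x, v⁆])
    (hmem : ⁅u, v⁆ ∈ Submodule.span K {⁅x, u⁆, ⁅x, v⁆})
    (hcenter : finrank K L ≤ finrank K (center K L) + 3) (hL : finrank K L = 5 + m) :
    Nonempty (L ≃ₗ⁅K⁆ N5_5 K × Ab K m) := by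
  wlog huv₀ : ⁅u, v⁆ = 0 generalizing u v
  · obtain ⟨α, β, hαβ⟩ := Submodule.mem_span_pair.1 hmem
    have hu : ⁅x, u - β • x⁆ = ⁅x, u⁆ := by rw [lie_sub, lie_smul, lie_self, smul_zero, sub_zero]
    have hv : ⁅x, v + α • x⁆ = ⁅x, v⁆ := by rw [lie_add, lie_smul, lie_self, smul_zero, add_zero]
    have huv₀ : ⁅u - β • x, v + α • x⁆ = 0 := by
      rw [sub_lie, smul_lie, hv, lie_add, lie_smul, ← lie_skew u x, ← hαβ]
      module
    exact this (by rwa [hu, hv]) (huv₀ ▸ zero_mem _) huv₀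
  obtain ⟨φ, hφ, hφZ, hframe⟩ := exists_coframe huv hcenter
  have hbr := lie_eq_of_coframe hframe
  simp only [huv₀, smul_zero, add_zero] at hbr
  obtain ⟨ω, hω⟩ := exists_dual_family_of_linearIndependent huv
  have hφd : ∀ i (y z : L), φ i ⁅y, z⁆ = 0 := fun i y z =>
    hφZ _ (h (lie_mem_lowerCentralSeries_one y z)) i
  refine nonempty_lieEquiv_alg_prod_ab (n5_5Table K) hφ hω
    (fun i => Fin.forall_fin_two.2 ⟨hφd i x u, hφd i x v⟩) (fun y z => ?_)
    (σ := ![.inl 0, .inl 1, .inr 0, .inl 2, .inr 1]) (by decide) (fun y z i => ?_) hL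
  · rw [Matrix.range_cons_cons_empty]
    exact Submodule.mem_span_pair.2 ⟨_, _, (hbr y z).symm⟩
  · have hωu : ∀ i, ω i ⁅x, u⁆ = if i = 0 then 1 else 0 := fun i => hω i 0
    have hωv : ∀ i, ω i ⁅x, v⁆ = if i = 1 then 1 else 0 := fun i => hω i 1
    have hωd : ω 0 ⁅y, z⁆ = wedge (φ 0) (φ 1) y z ∧ ω 1 ⁅y, z⁆ = wedge (φ 0) (φ 2) y z := by
      rw [hbr]
      simp [hωu, hωv]
    fin_cases i
    exacts [hφd 0 y z, hφd 1 y z, hωd.1, hφd 2 y z, hωd.2]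

theorem nonempty_lieEquiv_n6_20 [FiniteDimensional K L] {m : ℕ} {x u v : L}
    (h : lowerCentralSeries K L L 1 ≤ center K L)
    (huv : LinearIndependent K ![⁅x, u⁆, ⁅x, v⁆, ⁅u, v⁆])
    (hcenter : finrank K L ≤ finrank K (center K L) + 3) (hL : finrank K L = 6 + m) :
    Nonempty (L ≃ₗ⁅K⁆ N6_20 K × Ab K m) := by
  obtain ⟨φ, hφ, hφZ, hframe⟩ := exists_coframe (linearIndependent_lie_pairs huv).1 hcenter
  have hbr := lie_eq_of_coframe hframe
  obtain ⟨ω, hω⟩ := exists_dual_family_of_linearIndependent huv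
  have hφd : ∀ i (y z : L), φ i ⁅y, z⁆ = 0 := fun i y z =>
    hφZ _ (h (lie_mem_lowerCentralSeries_one y z)) i
  refine nonempty_lieEquiv_alg_prod_ab (n6_20Table K) hφ hω
    (fun i => Fin.forall_fin_succ.2 ⟨hφd i x u, Fin.forall_fin_two.2 ⟨hφd i x v, hφd i u v⟩⟩)
    (fun y z => ?_) (σ := ![.inl 0, .inl 1, .inr 0, .inl 2, .inr 1, .inr 2]) (by decide)
    (fun y z i => ?_) hL
  · exact (Submodule.mem_span_range_iff_exists_fun K).2
      ⟨![wedge (φ 0) (φ 1) y z, wedge (φ 0) (φ 2) y z, wedge (φ 1) (φ 2) y z],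
        (Fin.sum_univ_three _).trans (hbr y z).symm⟩
  · have hωxu : ∀ i, ω i ⁅x, u⁆ = if i = 0 then 1 else 0 := fun i => hω i 0
    have hωxv : ∀ i, ω i ⁅x, v⁆ = if i = 1 then 1 else 0 := fun i => hω i 1
    have hωuv : ∀ i, ω i ⁅u, v⁆ = if i = 2 then 1 else 0 := fun i => hω i 2
    have hωd : ω 0 ⁅y, z⁆ = wedge (φ 0) (φ 1) y z ∧ ω 1 ⁅y, z⁆ = wedge (φ 0) (φ 2) y z ∧
        ω 2 ⁅y, z⁆ = wedge (φ 1) (φ 2) y z := by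
      rw [hbr]
      simp [hωxu, hωxv, hωuv]
    fin_cases i
    exacts [hφd 0 y z, hφd 1 y z, hωd.1, hφd 2 y z, hωd.2.1, hωd.2.2]

end CenterOfCodimensionThree

section Pencil

open Module
open LieAlgebra (ad center)
open LieModule (lowerCentralSeries)

variable {K L : Type*} [Field K] [LieRing L] [LieAlgebra K L]

/-- The pencil normal form of a bracket whose values span the plane of `w₁` and `w₂`: its two
components are `e₁ ∧ a + e₂ ∧ b` and `e₁ ∧ b + e₂ ∧ d`, so that it is governed by the symmetric
matrix of functionals with rows `a, b` and `b, d`. -/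
structure PencilForm (w₁ w₂ : L) (e₁ e₂ a b d : Dual K L) : Prop where
  w_indep : LinearIndependent K ![w₁, w₂]
  e_indep : LinearIndependent K ![e₁, e₂]
  e₁_w : e₁ w₁ = 0 ∧ e₁ w₂ = 0
  e₂_w : e₂ w₁ = 0 ∧ e₂ w₂ = 0
  a_w : a w₁ = 0 ∧ a w₂ = 0
  b_w : b w₁ = 0 ∧ b w₂ = 0
  d_w : d w₁ = 0 ∧ d w₂ = 0
  bracket : ∀ x y : L, ⁅x, y⁆ = (wedge e₁ a x y + wedge e₂ b x y) • w₁ +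
    (wedge e₁ b x y + wedge e₂ d x y) • w₂

theorem IsSymplecticForm.linearIndependent {θ : LinearMap.BilinForm K L}
    (hθ : IsSymplecticForm K L θ) {ι : Type*} {w : ι → L} (hw : LinearIndependent K w) :
    LinearIndependent K (θ ∘ w) :=
  hw.map' θ (LinearMap.separatingLeft_iff_ker_eq_bot.1 hθ.2.1.1)

/-- By closedness, `θ z ⁅x, y⁆ = θ ⁅y, z⁆ x + θ ⁅z, x⁆ y` up to sign. -/
theorem IsSymplecticForm.apply_eq_zero_of_mem_center {θ : LinearMap.BilinForm K L}
    (hθ : IsSymplecticForm K L θ) {z w : L} (hz : z ∈ center K L)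
    (hw : w ∈ (lowerCentralSeries K L L 1).toSubmodule) : θ z w = 0 := by
  have hle : (lowerCentralSeries K L L 1).toSubmodule ≤ LinearMap.ker (θ z) := by
    refine lowerCentralSeries_one_le_iff.2 fun x y => LinearMap.mem_ker.2 ?_
    have hclosed := hθ.2.2 x y z
    rw [hz y, ← lie_skew z x, hz x, neg_zero, map_zero, LinearMap.zero_apply,
      LinearMap.zero_apply, add_zero, add_zero] at hclosed
    rw [← hθ.1.neg_eq, hclosed, neg_zero]
  exact hle hw

theorem IsSymplectic.exists_pencilForm [FiniteDimensional K L] (hs : IsSymplectic K L) {w₁ w₂ : L}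
    (hw : LinearIndependent K ![w₁, w₂])
    (hder : (lowerCentralSeries K L L 1).toSubmodule = Submodule.span K {w₁, w₂})
    (hcenter : lowerCentralSeries K L L 1 ≤ center K L) :
    ∃ e₁ e₂ a b d : Dual K L, PencilForm w₁ w₂ e₁ e₂ a b d := by
  obtain ⟨θ, hθ⟩ := hs
  obtain ⟨ω, hω⟩ := exists_dual_family_of_linearIndependent hw
  have hmem : w₁ ∈ (lowerCentralSeries K L L 1).toSubmodule ∧
      w₂ ∈ (lowerCentralSeries K L L 1).toSubmodule := by
    rw [hder]
    exact ⟨Submodule.subset_span (by simp), Submodule.subset_span (by simp)⟩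
  have hbr : ∀ x y : L, ⁅x, y⁆ = ω 0 ⁅x, y⁆ • w₁ + ω 1 ⁅x, y⁆ • w₂ := by
    intro x y
    have hxy := hder.le (lie_mem_lowerCentralSeries_one x y)
    rw [← Matrix.range_cons_cons_empty] at hxy
    exact (eq_sum_smul_of_mem_span_of_dual hω hxy).trans (Fin.sum_univ_two _)
  have hz : w₁ ∈ center K L ∧ w₂ ∈ center K L := ⟨hcenter hmem.1, hcenter hmem.2⟩
  have hθw : ∀ z ∈ center K L, θ z w₁ = 0 ∧ θ z w₂ = 0 := fun z hz =>
    ⟨hθ.apply_eq_zero_of_mem_center hz hmem.1, hθ.apply_eq_zero_of_mem_center hz hmem.2⟩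
  have he : LinearIndependent K ![θ w₁, θ w₂] := by
    have hθ_w : θ ∘ ![w₁, w₂] = ![θ w₁, θ w₂] := by
      ext i : 1
      fin_cases i <;> rfl
    exact hθ_w ▸ hθ.linearIndependent hw
  let β : Fin 2 → LinearMap.BilinForm K L := fun i => (ad K L : L →ₗ[K] L →ₗ[K] L).compr₂ (ω i)
  have hβ : ∀ i x y, β i x y = ω i ⁅x, y⁆ := fun _ _ _ => rfl
  have halt : ∀ i, (β i).IsAlt := fun i x => by rw [hβ, lie_self, map_zero]
  have hβc : ∀ i x, ∀ z ∈ center K L, β i x z = 0 := fun i x z hz => by rw [hβ, hz x, map_zero]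
  obtain ⟨a, b, d, h₀, h₁, hvanish⟩ := exists_wedge_eq_of_closed (halt 0) (halt 1) he
    fun x y z => by
      have hclosed := hθ.2.2 x y z
      rw [hbr x y, hbr y z, hbr z x] at hclosed
      simpa [hβ] using hclosed
  have habd : ∀ w ∈ center K L, θ w₁ w = 0 → a w = 0 ∧ b w = 0 ∧ d w = 0 := fun w hw hθw =>
    hvanish w hθw (fun x => hβc 0 x w hw) fun x => hβc 1 x w hw
  obtain ⟨ha₁, hb₁, hd₁⟩ := habd w₁ hz.1 (hθw w₁ hz.1).1
  obtain ⟨ha₂, hb₂, hd₂⟩ := habd w₂ hz.2 (hθw w₁ hz.1).2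
  exact ⟨θ w₁, θ w₂, a, b, d, hw, he, hθw _ hz.1, hθw _ hz.2, ⟨ha₁, ha₂⟩, ⟨hb₁, hb₂⟩, ⟨hd₁, hd₂⟩,
    fun x y => by rw [← h₀, ← h₁]; exact hbr x y⟩

theorem linearIndependent_pair_sub_smul {V : Type*} [AddCommGroup V] [Module K V] {x y : V}
    (h : LinearIndependent K ![x, y]) (c : K) : LinearIndependent K ![x, y - c • x] := by
  rw [sub_eq_neg_add, ← neg_smul]
  exact (LinearIndependent.pair_add_smul_right_iff _).2 h

namespace PencilForm

variable {w₁ w₂ : L} {e₁ e₂ a b d : Dual K L}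

theorem swap (h : PencilForm w₁ w₂ e₁ e₂ a b d) : PencilForm w₂ w₁ e₂ e₁ d b a where
  w_indep := LinearIndependent.pair_symm_iff.1 h.w_indep
  e_indep := LinearIndependent.pair_symm_iff.1 h.e_indep
  e₁_w := h.e₂_w.symm
  e₂_w := h.e₁_w.symm
  a_w := h.d_w.symm
  b_w := h.b_w.symm
  d_w := h.a_w.symm
  bracket x y := by
    rw [h.bracket]
    module

theorem shear (h : PencilForm w₁ w₂ e₁ e₂ a b d) (c : K) :
    PencilForm w₁ (w₂ - c • w₁) e₁ (e₂ - c • e₁) (a + (2 * c) • b + c ^ 2 • d) (b + c • d) d where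
  w_indep := linearIndependent_pair_sub_smul h.w_indep c
  e_indep := linearIndependent_pair_sub_smul h.e_indep c
  e₁_w := by simp [h.e₁_w]
  e₂_w := by simp [h.e₁_w, h.e₂_w]
  a_w := by simp [h.a_w, h.b_w, h.d_w]
  b_w := by simp [h.b_w, h.d_w]
  d_w := by simp [h.d_w]
  bracket x y := by
    rw [h.bracket]
    simp only [wedge, LinearMap.add_apply, LinearMap.sub_apply, LinearMap.smul_apply, smul_eq_mul]
    module

/-- Completing the square in the relation turns it into `d = μ a`. -/
theorem exists_diagonal_of_mem_span (h2 : (2 : K) ≠ 0) (h : PencilForm w₁ w₂ e₁ e₂ a b d)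
    (hd : d ∈ Submodule.span K {a, b, e₁, e₂}) :
    ∃ (w₁' w₂' : L) (e₁' e₂' a' b' : Dual K L) (μ : K),
      PencilForm w₁' w₂' e₁' e₂' a' b' (μ • a') := by
  obtain ⟨α, p, hp, hdp⟩ := Submodule.mem_span_insert.1 hd
  obtain ⟨β, q, hq, rfl⟩ := Submodule.mem_span_insert.1 hp
  obtain ⟨s, t, rfl⟩ := Submodule.mem_span_pair.1 hq
  subst hdp
  obtain ⟨c, rfl⟩ : ∃ c, β = -2 * c := ⟨-β / 2, by field_simp⟩
  have h' := (h.swap.shear c).swap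
  refine ⟨_, _, e₁ - c • e₂, e₂, a, b + c • a - s • e₂, α + c ^ 2,
    { h' with
      b_w := by simp [h.b_w, h.a_w, h.e₂_w]
      d_w := by simp [h.a_w]
      bracket := fun x y => ?_ }⟩
  rw [h'.bracket]
  simp only [wedge, LinearMap.add_apply, LinearMap.sub_apply, LinearMap.smul_apply, smul_eq_mul]
  module

/-- The shear by `1` puts `d` into the middle entry as well. -/
theorem exists_diagonal_of_mem_span_pair (h2 : (2 : K) ≠ 0) (h : PencilForm w₁ w₂ e₁ e₂ a b d)
    (hb : b ∈ Submodule.span K {e₁, e₂}) :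
    ∃ (w₁' w₂' : L) (e₁' e₂' a' b' : Dual K L) (μ : K),
      PencilForm w₁' w₂' e₁' e₂' a' b' (μ • a') := by
  obtain ⟨s, t, hst⟩ := Submodule.mem_span_pair.1 hb
  refine (h.shear 1).exists_diagonal_of_mem_span h2 ?_
  have hd : d = (b + (1 : K) • d) - ((s + t) • e₁ + t • (e₂ - (1 : K) • e₁)) := by
    rw [← hst]
    module
  generalize b + (1 : K) • d = b' at hd ⊢
  rw [hd]
  refine sub_mem (Submodule.subset_span ?_) (add_mem (Submodule.smul_mem _ _
    (Submodule.subset_span ?_)) (Submodule.smul_mem _ _ (Submodule.subset_span ?_))) <;> simp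

theorem exists_diagonal (h2 : (2 : K) ≠ 0) (h : PencilForm w₁ w₂ e₁ e₂ a b d)
    (hdep : ¬ LinearIndependent K ![e₂, e₁, a, b, d]) :
    ∃ (w₁' w₂' : L) (e₁' e₂' a' b' : Dual K L) (μ : K),
      PencilForm w₁' w₂' e₁' e₂' a' b' (μ • a') := by
  by_cases hd : d ∈ Submodule.span K {a, b, e₁, e₂}
  · exact h.exists_diagonal_of_mem_span h2 hd
  by_cases ha : a ∈ Submodule.span K {b, e₁, e₂}
  · refine h.swap.exists_diagonal_of_mem_span h2 (Submodule.span_mono ?_ ha)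
    grind
  by_cases hb : b ∈ Submodule.span K {e₁, e₂}
  · exact h.exists_diagonal_of_mem_span_pair h2 hb
  · have hind : LinearIndependent K ![d, a, b, e₁, e₂] := by
      refine linearIndependent_finCons.2 ⟨linearIndependent_finCons.2
        ⟨linearIndependent_finCons.2 ⟨h.e_indep, ?_⟩, ?_⟩, ?_⟩
      · rwa [Matrix.range_cons_cons_empty]
      · rwa [Matrix.range_cons, Matrix.range_cons_cons_empty, Set.singleton_union]
      · rwa [Matrix.range_cons, Matrix.range_cons, Matrix.range_cons_cons_empty,
          Set.singleton_union, Set.singleton_union]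
    refine absurd ?_ hdep
    convert hind.comp ![4, 3, 1, 2, 0] (by decide) using 1
    ext i : 1
    fin_cases i <;> rfl

end PencilForm

end Pencil

section PencilModels

open Module
open LieAlgebra (center)
open LieModule (lowerCentralSeries)

variable {K L : Type*} [Field K] [LieRing L] [LieAlgebra K L]

theorem wedge_neg_swap {V : Type*} [AddCommGroup V] [Module K V] (f g : Dual K V) (x y : V) :
    wedge g (-f) x y = wedge f g x y := by
  simp only [wedge, LinearMap.neg_apply]
  ring

theorem wedge_neg_right {V : Type*} [AddCommGroup V] [Module K V] (f g : Dual K V) (x y : V) :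
    wedge f (-g) x y = -wedge f g x y := by
  simp only [wedge, LinearMap.neg_apply]
  ring

theorem wedge_zero_right {V : Type*} [AddCommGroup V] [Module K V] (f : Dual K V) (x y : V) :
    wedge f 0 x y = 0 := by
  simp only [wedge, LinearMap.zero_apply, mul_zero, zero_mul, sub_zero]

theorem wedge_add_smul_of_sq_eq_one {V : Type*} [AddCommGroup V] [Module K V] {ε : K}
    (hε : ε ^ 2 = 1) (e₁ e₂ a b : Dual K V) (x y : V) :
    wedge (e₁ + ε • e₂) (b + ε • a) x y =
      wedge e₁ b x y + wedge e₂ a x y + ε * (wedge e₁ a x y + wedge e₂ b x y) := by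
  simp only [wedge, LinearMap.add_apply, LinearMap.smul_apply, smul_eq_mul]
  linear_combination (e₂ x * a y - a x * e₂ y) * hε

theorem linearIndependent_vecCons_smul {V : Type*} [AddCommGroup V] [Module K V] {n : ℕ} {x : V}
    {v : Fin n → V} {c : K} (hc : c ≠ 0) (h : LinearIndependent K (Matrix.vecCons x v)) :
    LinearIndependent K (Matrix.vecCons (c • x) v) :=
  have hxv := linearIndependent_finCons.1 h
  linearIndependent_finCons.2 ⟨hxv.1, (Submodule.smul_mem_iff _ hc).not.2 hxv.2⟩

theorem linearIndependent_vecCons_neg {V : Type*} [AddCommGroup V] [Module K V] {n : ℕ} {x : V}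
    {v : Fin n → V} (h : LinearIndependent K (Matrix.vecCons x v)) :
    LinearIndependent K (Matrix.vecCons (-x) v) :=
  neg_one_smul K x ▸ linearIndependent_vecCons_smul (neg_ne_zero.2 one_ne_zero) h

namespace PencilForm

variable {w₁ w₂ : L} {e₁ e₂ a b d : Dual K L}

theorem scale {k : K} (hk : k ≠ 0) (h : PencilForm w₁ w₂ e₁ e₂ a b d) :
    PencilForm (k⁻¹ • w₁) w₂ e₁ (k • e₂) (k • a) b (k⁻¹ • d) where
  w_indep := linearIndependent_vecCons_smul (inv_ne_zero hk) h.w_indep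
  e_indep := LinearIndependent.pair_symm_iff.1
    (linearIndependent_vecCons_smul hk (LinearIndependent.pair_symm_iff.1 h.e_indep))
  e₁_w := by simp [h.e₁_w]
  e₂_w := by simp [h.e₂_w]
  a_w := by simp [h.a_w]
  b_w := by simp [h.b_w]
  d_w := by simp [h.d_w]
  bracket x y := by
    rw [h.bracket]
    simp only [wedge, LinearMap.smul_apply, smul_eq_mul, smul_smul]
    congr 2 <;> field_simp

theorem lie_mem_span (h : PencilForm w₁ w₂ e₁ e₂ a b d) (x y : L) :
    ⁅x, y⁆ ∈ Submodule.span K (Set.range ![w₁, w₂]) := by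
  rw [Matrix.range_cons_cons_empty]
  exact Submodule.mem_span_pair.2 ⟨_, _, (h.bracket x y).symm⟩

theorem apply_lie_eq_zero (h : PencilForm w₁ w₂ e₁ e₂ a b d) {φ : Dual K L}
    (hφ : φ w₁ = 0 ∧ φ w₂ = 0) (x y : L) : φ ⁅x, y⁆ = 0 := by
  rw [h.bracket, map_add, map_smul, map_smul, hφ.1, hφ.2, smul_zero, smul_zero, add_zero]

theorem exists_coordinates (h : PencilForm w₁ w₂ e₁ e₂ a b d) :
    ∃ ω : Fin 2 → Dual K L, (∀ i j, ω i (![w₁, w₂] j) = if i = j then 1 else 0) ∧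
      (∀ x y : L, ω 0 ⁅x, y⁆ = wedge e₁ a x y + wedge e₂ b x y) ∧
      ∀ x y : L, ω 1 ⁅x, y⁆ = wedge e₁ b x y + wedge e₂ d x y := by
  obtain ⟨ω, hω⟩ := exists_dual_family_of_linearIndependent h.w_indep
  have hω₁ : ∀ i, ω i w₁ = if i = 0 then 1 else 0 := fun i => hω i 0
  have hω₂ : ∀ i, ω i w₂ = if i = 1 then 1 else 0 := fun i => hω i 1
  refine ⟨ω, hω, fun x y => ?_, fun x y => ?_⟩ <;> simp [h.bracket x y, hω₁, hω₂]

theorem finrank_le_finrank_center_add_three [FiniteDimensional K L] {μ : K}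
    (h : PencilForm w₁ w₂ e₁ e₂ a b (μ • a)) (hdep : ¬ LinearIndependent K ![e₂, e₁, a, b]) :
    finrank K L ≤ finrank K (center K L) + 3 := by
  have hcenter : ∀ z, (∀ i, ![e₂, e₁, a, b] i z = 0) → z ∈ center K L := fun z hz y => by
    have h₂ : e₂ z = 0 := hz 0
    have h₁ : e₁ z = 0 := hz 1
    have ha : a z = 0 := hz 2
    have hb : b z = 0 := hz 3
    simp [h.bracket y z, wedge, h₁, h₂, ha, hb]
  have hspan : finrank K (Submodule.span K (Set.range ![e₂, e₁, a, b])) < 4 :=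
    lt_of_not_ge fun hle => hdep (linearIndependent_iff_card_le_finrank_span.2 hle)
  have := finrank_le_finrank_center_add_finrank_span hcenter
  omega

theorem nonempty_lieEquiv_n7_124 [FiniteDimensional K L] {m : ℕ}
    (h : PencilForm w₁ w₂ e₁ e₂ a b d) (hind : LinearIndependent K ![e₂, e₁, a, b, d])
    (hL : finrank K L = 7 + m) : Nonempty (L ≃ₗ⁅K⁆ N7_124 K × Ab K m) := by
  obtain ⟨ω, hω, hω₀, hω₁⟩ := h.exists_coordinates
  simp only [← wedge_neg_swap e₂] at hω₀ hω₁
  have hg : LinearIndependent K ![-e₂, e₁, a, b, d] := linearIndependent_vecCons_neg hind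
  have hgw : ∀ i, ![-e₂, e₁, a, b, d] i w₁ = 0 ∧ ![-e₂, e₁, a, b, d] i w₂ = 0 := by
    intro i
    fin_cases i
    exacts [by simp [h.e₂_w], h.e₁_w, h.a_w, h.b_w, h.d_w]
  have hgd := fun i => h.apply_lie_eq_zero (hgw i)
  refine nonempty_lieEquiv_alg_prod_ab (n7_124Table K) hg hω
    (fun i => Fin.forall_fin_two.2 (hgw i)) h.lie_mem_span
    (σ := ![.inl 1, .inl 2, .inr 0, .inl 3, .inr 1, .inl 4, .inl 0]) (by decide)
    (fun x y i => ?_) hL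
  fin_cases i
  exacts [hgd 1 x y, hgd 2 x y, hω₀ x y, hgd 3 x y, hω₁ x y, hgd 4 x y, hgd 0 x y]

theorem nonempty_lieEquiv_n6_19 [FiniteDimensional K L] {m : ℕ}
    (h : PencilForm w₁ w₂ e₁ e₂ a b 0) (hind : LinearIndependent K ![e₂, e₁, a, b])
    (hL : finrank K L = 6 + m) : Nonempty (L ≃ₗ⁅K⁆ N6_19 K × Ab K m) := by
  obtain ⟨ω, hω, hω₀, hω₁⟩ := h.exists_coordinates
  simp only [← wedge_neg_swap e₂ b] at hω₀
  simp only [wedge_zero_right, add_zero] at hω₁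
  have hg : LinearIndependent K ![-e₂, e₁, a, b] := linearIndependent_vecCons_neg hind
  have hgw : ∀ i, ![-e₂, e₁, a, b] i w₁ = 0 ∧ ![-e₂, e₁, a, b] i w₂ = 0 := by
    intro i
    fin_cases i
    exacts [by simp [h.e₂_w], h.e₁_w, h.a_w, h.b_w]
  have hgd := fun i => h.apply_lie_eq_zero (hgw i)
  refine nonempty_lieEquiv_alg_prod_ab (n6_19Table K) hg hω
    (fun i => Fin.forall_fin_two.2 (hgw i)) h.lie_mem_span
    (σ := ![.inl 1, .inl 3, .inr 1, .inl 2, .inr 0, .inl 0]) (by decide) (fun x y i => ?_) hL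
  fin_cases i
  exacts [hgd 1 x y, hgd 3 x y, hω₁ x y, hgd 2 x y, hω₀ x y, hgd 0 x y]

theorem nonempty_lieEquiv_n6_20_1 [FiniteDimensional K L] {m : ℕ}
    (h : PencilForm w₁ w₂ e₁ e₂ a b (-a)) (hind : LinearIndependent K ![e₂, e₁, a, b])
    (hL : finrank K L = 6 + m) : Nonempty (L ≃ₗ⁅K⁆ N6_20_1 K × Ab K m) := by
  obtain ⟨ω, hω, hω₀, hω₁⟩ := h.exists_coordinates
  simp only [← wedge_neg_swap e₂ b] at hω₀
  have hω₁' : ∀ x y : L, ω 1 ⁅x, y⁆ = wedge e₁ b x y - wedge a (-e₂) x y := fun x y => by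
    rw [hω₁, wedge_neg_swap, sub_eq_add_neg, wedge_neg_right a, neg_neg]
  have hg : LinearIndependent K ![-e₂, e₁, a, b] := linearIndependent_vecCons_neg hind
  have hgw : ∀ i, ![-e₂, e₁, a, b] i w₁ = 0 ∧ ![-e₂, e₁, a, b] i w₂ = 0 := by
    intro i
    fin_cases i
    exacts [by simp [h.e₂_w], h.e₁_w, h.a_w, h.b_w]
  have hgd := fun i => h.apply_lie_eq_zero (hgw i)
  refine nonempty_lieEquiv_alg_prod_ab (n6_20_1Table K) hg hω
    (fun i => Fin.forall_fin_two.2 (hgw i)) h.lie_mem_span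
    (σ := ![.inl 1, .inl 2, .inr 0, .inl 3, .inr 1, .inl 0]) (by decide) (fun x y i => ?_) hL
  fin_cases i
  exacts [hgd 1 x y, hgd 2 x y, hω₀ x y, hgd 3 x y, hω₁' x y, hgd 0 x y]

/-- Since `ε ^ 2 = 1`, the form `(e₁ + ε e₂) ∧ (b + ε a)` is a combination of the two components of
the bracket. -/
theorem exists_lieHom_n3_1 (h : PencilForm w₁ w₂ e₁ e₂ a b a) {ω : Fin 2 → Dual K L}
    (hω₀ : ∀ x y : L, ω 0 ⁅x, y⁆ = wedge e₁ a x y + wedge e₂ b x y)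
    (hω₁ : ∀ x y : L, ω 1 ⁅x, y⁆ = wedge e₁ b x y + wedge e₂ a x y) {ε : K} (hε : ε ^ 2 = 1) :
    ∃ π : L →ₗ⁅K⁆ N3_1 K, ∀ x,
      π x = ![e₁ x + ε * e₂ x, b x + ε * a x, ω 1 x + ε * ω 0 x] := by
  let p : Fin 3 → Dual K L := ![e₁ + ε • e₂, b + ε • a, ω 1 + ε • ω 0]
  have hp : ∀ (x y : L) (i), p i ⁅x, y⁆ =
      (n3_1Table K).br (fun j => p j x) (fun j => p j y) i := by
    intro x y i
    have hadd : ∀ {f g : Dual K L}, (f w₁ = 0 ∧ f w₂ = 0) → (g w₁ = 0 ∧ g w₂ = 0) →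
        (f + ε • g) ⁅x, y⁆ = 0 := fun hf hg => by
      rw [LinearMap.add_apply, LinearMap.smul_apply, h.apply_lie_eq_zero hf, h.apply_lie_eq_zero hg,
        smul_zero, add_zero]
    have hω_lie : (ω 1 + ε • ω 0) ⁅x, y⁆ = wedge (e₁ + ε • e₂) (b + ε • a) x y := by
      rw [wedge_add_smul_of_sq_eq_one hε, LinearMap.add_apply, LinearMap.smul_apply, hω₀, hω₁,
        smul_eq_mul]
    fin_cases i
    exacts [hadd h.e₁_w h.e₂_w, hadd h.b_w h.a_w, hω_lie]
  exact ⟨(n3_1Table K).lift p hp, fun x => funext fun i => by fin_cases i <;> rfl⟩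

theorem exists_surjective_lieHom_n3_1_prod_n3_1 [FiniteDimensional K L] (h2 : (2 : K) ≠ 0)
    (h : PencilForm w₁ w₂ e₁ e₂ a b a) (hind : LinearIndependent K ![e₂, e₁, a, b]) :
    ∃ π : L →ₗ⁅K⁆ N3_1 K × N3_1 K, Function.Surjective π ∧
      ∀ w ∈ lowerCentralSeries K L L 1, π w = 0 → w = 0 := by
  obtain ⟨ω, hω, hω₀, hω₁⟩ := h.exists_coordinates
  have hgw : ∀ i, ![e₂, e₁, a, b] i w₁ = 0 ∧ ![e₂, e₁, a, b] i w₂ = 0 := by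
    intro i
    fin_cases i
    exacts [h.e₂_w, h.e₁_w, h.a_w, h.b_w]
  obtain ⟨π, hπ⟩ := h.exists_lieHom_n3_1 hω₀ hω₁ (one_pow 2)
  obtain ⟨ρ, hρ⟩ := h.exists_lieHom_n3_1 hω₀ hω₁ neg_one_sq
  refine ⟨π.prod ρ, fun c => ?_, fun w hw hπρ => ?_⟩
  · obtain ⟨x, hx, hωx⟩ := exists_apply_eq_of_dual hind hω
      (fun i => Fin.forall_fin_two.2 (hgw i))
      ![(c.1 0 - c.2 0) / 2, (c.1 0 + c.2 0) / 2, (c.1 1 - c.2 1) / 2, (c.1 1 + c.2 1) / 2]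
      ![(c.1 2 - c.2 2) / 2, (c.1 2 + c.2 2) / 2]
    have he₂ : e₂ x = (c.1 0 - c.2 0) / 2 := hx 0
    have he₁ : e₁ x = (c.1 0 + c.2 0) / 2 := hx 1
    have ha : a x = (c.1 1 - c.2 1) / 2 := hx 2
    have hb : b x = (c.1 1 + c.2 1) / 2 := hx 3
    have hω₀x : ω 0 x = (c.1 2 - c.2 2) / 2 := hωx 0
    have hω₁x : ω 1 x = (c.1 2 + c.2 2) / 2 := hωx 1
    have hplus : ∀ s t : K, (s + t) / 2 + 1 * ((s - t) / 2) = s := fun s t => by field_simp; ring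
    have hminus : ∀ s t : K, (s + t) / 2 + -1 * ((s - t) / 2) = t := fun s t => by field_simp; ring
    refine ⟨x, Prod.ext ((hπ x).trans ?_) ((hρ x).trans ?_)⟩ <;>
      rw [he₁, he₂, ha, hb, hω₀x, hω₁x] <;> funext i <;> fin_cases i
    exacts [hplus _ _, hplus _ _, hplus _ _, hminus _ _, hminus _ _, hminus _ _]
  · have hplus : ω 1 w + 1 * ω 0 w = 0 :=
      congrFun ((hπ w).symm.trans (congrArg Prod.fst hπρ)) 2
    have hminus : ω 1 w + -1 * ω 0 w = 0 :=
      congrFun ((hρ w).symm.trans (congrArg Prod.snd hπρ)) 2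
    have hω_w : ∀ j, ω j w = 0 := Fin.forall_fin_two.2
      ⟨(mul_eq_zero.1 (by linear_combination hplus - hminus : 2 * ω 0 w = 0)).resolve_left h2,
        (mul_eq_zero.1 (by linear_combination hplus + hminus : 2 * ω 1 w = 0)).resolve_left h2⟩
    rw [eq_sum_smul_of_mem_span_of_dual hω (lowerCentralSeries_one_le_iff.2 h.lie_mem_span hw)]
    simp only [hω_w, zero_smul, Finset.sum_const_zero]

theorem nonempty_lieEquiv_n3_1_prod_n3_1 [FiniteDimensional K L] {m : ℕ} (h2 : (2 : K) ≠ 0)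
    (h : PencilForm w₁ w₂ e₁ e₂ a b a) (hind : LinearIndependent K ![e₂, e₁, a, b])
    (hL : finrank K L = 6 + m) : Nonempty (L ≃ₗ⁅K⁆ N3_1 K × N3_1 K × Ab K m) := by
  obtain ⟨π, hπ, hker⟩ := h.exists_surjective_lieHom_n3_1_prod_n3_1 h2 hind
  obtain ⟨e⟩ := nonempty_lieEquiv_prod_ab π hπ hker (by
    rw [finrank_prod, BracketTable.finrank_alg, hL])
  exact ⟨e.trans { LinearEquiv.prodAssoc K (N3_1 K) (N3_1 K) (Ab K m) with map_lie' := rfl }⟩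

end PencilForm

end PencilModels

section Classification

open Module
open LieAlgebra (center)
open LieModule (lowerCentralSeries)

variable {K L : Type*} [Field K] [LieRing L] [LieAlgebra K L]

namespace PencilForm

variable {w₁ w₂ : L} {e₁ e₂ a b : Dual K L} {μ k : K}

theorem linearIndependent_scale (hk : k ≠ 0) (hind : LinearIndependent K ![e₂, e₁, a, b]) :
    LinearIndependent K ![k • e₂, e₁, k • a, b] := by
  convert hind.units_smul ![Units.mk0 k hk, 1, Units.mk0 k hk, 1] using 1
  ext i : 1
  fin_cases i
  exacts [rfl, (one_smul K e₁).symm, rfl, (one_smul K b).symm]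

theorem nonempty_lieEquiv_of_isSquare [FiniteDimensional K L] {m : ℕ} (h2 : (2 : K) ≠ 0)
    (h : PencilForm w₁ w₂ e₁ e₂ a b (μ • a)) (hind : LinearIndependent K ![e₂, e₁, a, b])
    (hμ : IsSquare μ) (hL : finrank K L = 6 + m) :
    Nonempty (L ≃ₗ⁅K⁆ N6_19 K × Ab K m) ∨ Nonempty (L ≃ₗ⁅K⁆ N3_1 K × N3_1 K × Ab K m) := by
  obtain ⟨k, rfl⟩ := hμ
  rcases eq_or_ne k 0 with rfl | hk
  · rw [mul_zero, zero_smul] at h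
    exact .inl (h.nonempty_lieEquiv_n6_19 hind hL)
  · have hscale := h.scale hk
    rw [smul_smul, inv_mul_cancel_left₀ hk] at hscale
    exact .inr (hscale.nonempty_lieEquiv_n3_1_prod_n3_1 h2 (linearIndependent_scale hk hind) hL)

theorem nonempty_lieEquiv_of_isSquare_neg [FiniteDimensional K L] {m : ℕ} (hμ₀ : μ ≠ 0)
    (h : PencilForm w₁ w₂ e₁ e₂ a b (μ • a)) (hind : LinearIndependent K ![e₂, e₁, a, b])
    (hμ : IsSquare (-μ)) (hL : finrank K L = 6 + m) :
    Nonempty (L ≃ₗ⁅K⁆ N6_20_1 K × Ab K m) := by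
  obtain ⟨k, hkμ⟩ := hμ
  have hk : k ≠ 0 := fun hk => hμ₀ (by rwa [hk, mul_zero, neg_eq_zero] at hkμ)
  have hscale := h.scale hk
  rw [smul_smul, neg_eq_iff_eq_neg.1 hkμ, mul_neg, inv_mul_cancel_left₀ hk, neg_smul] at hscale
  exact hscale.nonempty_lieEquiv_n6_20_1 (linearIndependent_scale hk hind) hL

theorem finrank_le_finrank_center_add_five [FiniteDimensional K L] {d : Dual K L}
    (h : PencilForm w₁ w₂ e₁ e₂ a b d) : finrank K L ≤ finrank K (center K L) + 5 := by
  have hcenter : ∀ z, (∀ i, ![e₂, e₁, a, b, d] i z = 0) → z ∈ center K L := fun z hz y => by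
    have h₂ : e₂ z = 0 := hz 0
    have h₁ : e₁ z = 0 := hz 1
    have ha : a z = 0 := hz 2
    have hb : b z = 0 := hz 3
    have hd : d z = 0 := hz 4
    simp [h.bracket y z, wedge, h₁, h₂, ha, hb, hd]
  exact (finrank_le_finrank_center_add_finrank_span hcenter).trans
    (Nat.add_le_add_left (finrank_range_le_card _) _)

end PencilForm

theorem isDecomposable_of_lowerCentralSeries_eq_span_pair [FiniteDimensional K L]
    (hs : IsSymplectic K L) {w₁ w₂ : L} (hw : LinearIndependent K ![w₁, w₂])
    (hder : (lowerCentralSeries K L L 1).toSubmodule = Submodule.span K {w₁, w₂})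
    (h : lowerCentralSeries K L L 1 ≤ center K L) (hL : 8 ≤ finrank K L) : IsDecomposable K L := by
  obtain ⟨e₁, e₂, a, b, d, hpencil⟩ := hs.exists_pencilForm hw hder h
  have hcenter := hpencil.finrank_le_finrank_center_add_five
  have hrank : finrank K (lowerCentralSeries K L L 1).toSubmodule = 2 := by
    rw [hder, ← Matrix.range_cons_cons_empty, finrank_span_eq_card hw, Fintype.card_fin]
  refine isDecomposable_of_finrank_lt (hrank.trans_lt (by omega)) ?_
  by_contra! hab
  have hbot : (lowerCentralSeries K L L 1).toSubmodule ≤ ⊥ :=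
    lowerCentralSeries_one_le_iff.2 fun x y => (Submodule.mem_bot K).2 (hab x y)
  exact hw.ne_zero 0 ((Submodule.mem_bot K).1 (hbot (hder.ge (Submodule.subset_span (.inl rfl)))))

theorem finrank_lowerCentralSeries_one_le_three [FiniteDimensional K L] {x u v : L}
    (huv : LinearIndependent K ![⁅x, u⁆, ⁅x, v⁆])
    (hcenter : finrank K L ≤ finrank K (center K L) + 3) :
    finrank K (lowerCentralSeries K L L 1) ≤ 3 := by
  obtain ⟨φ, -, -, hφ⟩ := exists_coframe huv hcenter
  have hle : (lowerCentralSeries K L L 1).toSubmodule ≤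
      Submodule.span K (Set.range ![⁅x, u⁆, ⁅x, v⁆, ⁅u, v⁆]) :=
    lowerCentralSeries_one_le_iff.2 fun y z => (Submodule.mem_span_range_iff_exists_fun K).2
      ⟨![wedge (φ 0) (φ 1) y z, wedge (φ 0) (φ 2) y z, wedge (φ 1) (φ 2) y z],
        (Fin.sum_univ_three _).trans (lie_eq_of_coframe hφ y z).symm⟩
  exact (Submodule.finrank_mono hle).trans (finrank_range_le_card _)

theorem HasBreadth.lowerCentralSeries_one_eq_span [Infinite K] [FiniteDimensional K L]
    (h : HasBreadth K L 2) {x u v : L} (huv : LinearIndependent K ![⁅x, u⁆, ⁅x, v⁆])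
    (hmem : ⁅u, v⁆ ∈ Submodule.span K {⁅x, u⁆, ⁅x, v⁆}) :
    (lowerCentralSeries K L L 1).toSubmodule = Submodule.span K {⁅x, u⁆, ⁅x, v⁆} :=
  le_antisymm (lowerCentralSeries_one_le_iff.2 (h.lie_mem_span_of_lie_mem_span huv hmem))
    (Submodule.span_le.2 (Set.pair_subset (lie_mem_lowerCentralSeries_one x u)
      (lie_mem_lowerCentralSeries_one x v)))

theorem linearIndependent_lie_of_lie_notMem_span {x u v : L}
    (huv : LinearIndependent K ![⁅x, u⁆, ⁅x, v⁆])
    (hnot : ⁅u, v⁆ ∉ Submodule.span K {⁅x, u⁆, ⁅x, v⁆}) :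
    LinearIndependent K ![⁅x, u⁆, ⁅x, v⁆, ⁅u, v⁆] := by
  have hcons : LinearIndependent K ![⁅u, v⁆, ⁅x, u⁆, ⁅x, v⁆] :=
    linearIndependent_finCons.2 ⟨huv, by rwa [Matrix.range_cons_cons_empty]⟩
  convert hcons.comp ![1, 2, 0] (by decide) using 1
  ext i : 1
  fin_cases i <;> rfl

namespace IsSymplecticOfType221111

theorem isDecomposable [Infinite K] (h : IsSymplecticOfType221111 K L) : IsDecomposable K L := by
  obtain ⟨hL, hcenter, hs, hbreadth⟩ := (isSymplecticOfType221111_iff K L).1 h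
  have : FiniteDimensional K L := FiniteDimensional.of_finrank_pos (by omega)
  obtain ⟨x, u, v, huv⟩ := hbreadth.exists_linearIndependent_lie
  by_cases hmem : ⁅u, v⁆ ∈ Submodule.span K {⁅x, u⁆, ⁅x, v⁆}
  · exact isDecomposable_of_lowerCentralSeries_eq_span_pair hs huv
      (hbreadth.lowerCentralSeries_one_eq_span huv hmem) hcenter hL.ge
  · have hthree := hbreadth.finrank_le_finrank_center_add_three
      (linearIndependent_lie_of_lie_notMem_span huv hmem)
    have hder := finrank_lowerCentralSeries_one_le_three huv hthree
    exact isDecomposable_of_finrank_lt (by omega) (hbreadth.exists_lie_ne_zero two_pos)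

theorem isInCommonList_or_exists_pencilForm [Infinite K] (h2 : (2 : K) ≠ 0)
    (h : IsSymplecticOfType221111 K L) :
    IsInCommonList K L ∨ ∃ (w₁ w₂ : L) (e₁ e₂ a b : Dual K L) (μ : K),
      PencilForm w₁ w₂ e₁ e₂ a b (μ • a) ∧ LinearIndependent K ![e₂, e₁, a, b] ∧
        ¬ IsSquare μ := by
  obtain ⟨hL, hcenter, hs, hbreadth⟩ := (isSymplecticOfType221111_iff K L).1 h
  have : FiniteDimensional K L := FiniteDimensional.of_finrank_pos (by omega)
  obtain ⟨x, u, v, huv⟩ := hbreadth.exists_linearIndependent_lie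
  by_cases hmem : ⁅u, v⁆ ∈ Submodule.span K {⁅x, u⁆, ⁅x, v⁆}
  swap
  · have hind := linearIndependent_lie_of_lie_notMem_span huv hmem
    exact .inl (.inr (.inr (.inl (nonempty_lieEquiv_n6_20 hcenter hind
      (hbreadth.finrank_le_finrank_center_add_three hind) hL))))
  obtain ⟨e₁, e₂, a, b, d, hpencil⟩ := hs.exists_pencilForm huv
    (hbreadth.lowerCentralSeries_one_eq_span huv hmem) hcenter
  by_cases hind : LinearIndependent K ![e₂, e₁, a, b, d]
  · exact .inl (.inl (hpencil.nonempty_lieEquiv_n7_124 hind hL))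
  obtain ⟨w₁, w₂, e₁, e₂, a, b, μ, hdiag⟩ := hpencil.exists_diagonal h2 hind
  by_cases hind : LinearIndependent K ![e₂, e₁, a, b]
  swap
  · exact .inl (.inr (.inr (.inr (.inl (nonempty_lieEquiv_n5_5 hcenter huv hmem
      (hdiag.finrank_le_finrank_center_add_three hind) hL)))))
  by_cases hμ : IsSquare μ
  · rcases hdiag.nonempty_lieEquiv_of_isSquare (m := 2) h2 hind hμ hL with h19 | h33
    exacts [.inl (.inr (.inl h19)), .inl (.inr (.inr (.inr (.inr h33))))]
  · exact .inr ⟨w₁, w₂, e₁, e₂, a, b, μ, hdiag, hind, hμ⟩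

theorem isInCommonList [Infinite K] (h2 : (2 : K) ≠ 0) (hsq : ∀ x : K, IsSquare x)
    (h : IsSymplecticOfType221111 K L) : IsInCommonList K L :=
  (h.isInCommonList_or_exists_pencilForm h2).resolve_right
    fun ⟨_, _, _, _, _, _, μ, _, _, hμ⟩ => hμ (hsq μ)

theorem isInCommonList_or_nonempty_lieEquiv_n6_20_1 [Infinite K] (h2 : (2 : K) ≠ 0)
    (hsq : ∀ x : K, IsSquare x ∨ IsSquare (-x)) (h : IsSymplecticOfType221111 K L) :
    IsInCommonList K L ∨ Nonempty (L ≃ₗ⁅K⁆ N6_20_1 K × Ab K 2) := by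
  refine (h.isInCommonList_or_exists_pencilForm h2).imp_right ?_
  rintro ⟨w₁, w₂, e₁, e₂, a, b, μ, hdiag, hind, hμ⟩
  have : FiniteDimensional K L := FiniteDimensional.of_finrank_pos (by rw [h.1]; norm_num)
  have hμ₀ : μ ≠ 0 := fun h₀ => hμ (h₀ ▸ IsSquare.zero)
  exact hdiag.nonempty_lieEquiv_of_isSquare_neg hμ₀ hind ((hsq μ).resolve_left hμ) h.1

end IsSymplecticOfType221111

end Classification

section Models

open Module
open LieAlgebra (ad center)
open LieModule (lowerCentralSeries)

variable {K L M : Type*} [Field K] [LieRing L] [LieAlgebra K L] [LieRing M] [LieAlgebra K M]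

/-- `b` is a Darboux basis for the form `∑ i, b.coord (σ i) ∧ b.coord (τ i)`. -/
theorem isSymplectic_of_basis {ι κ : Type*} [Fintype κ] (b : Basis ι K L) {σ τ : κ → ι}
    (hστ : Function.Bijective (Sum.elim σ τ))
    (hclosed : ∀ x y z : L, ∑ i, (wedge (b.coord (σ i)) (b.coord (τ i)) ⁅x, y⁆ z +
      wedge (b.coord (σ i)) (b.coord (τ i)) ⁅y, z⁆ x +
      wedge (b.coord (σ i)) (b.coord (τ i)) ⁅z, x⁆ y) = 0) : IsSymplectic K L := by
  classical
  obtain ⟨hσ, hτ, hne⟩ := Sum.elim_injective.1 hστ.injective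
  let θ : LinearMap.BilinForm K L :=
    ∑ i, (LinearMap.BilinForm.linMulLin (b.coord (σ i)) (b.coord (τ i)) -
      LinearMap.BilinForm.linMulLin (b.coord (τ i)) (b.coord (σ i)))
  have hθ : ∀ x y, θ x y = ∑ i, wedge (b.coord (σ i)) (b.coord (τ i)) x y := fun x y => by
    simp [θ, wedge, LinearMap.sum_apply]
  have halt : θ.IsAlt := fun x => by
    rw [hθ]
    exact Finset.sum_eq_zero fun i _ => by rw [wedge, mul_comm, sub_self]
  have hσb : ∀ x i, θ x (b (τ i)) = b.coord (σ i) x := fun x i => by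
    simp [hθ, wedge, Finsupp.single_apply, hτ.eq_iff, hne]
  have hτb : ∀ x i, θ x (b (σ i)) = -b.coord (τ i) x := fun x i => by
    simp [hθ, wedge, Finsupp.single_apply, hσ.eq_iff, (hne _ _).symm]
  have hleft : θ.SeparatingLeft := fun x hx => b.forall_coord_eq_zero_iff.1 fun j => by
    obtain ⟨i | i, rfl⟩ := hστ.surjective j
    · exact (hσb x i).symm.trans (hx _)
    · exact neg_eq_zero.1 ((hτb x i).symm.trans (hx _))
  refine ⟨θ, halt, halt.isRefl.nondegenerate_iff_separatingLeft.2 hleft, fun x y z => ?_⟩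
  simpa only [hθ, Finset.sum_add_distrib] using hclosed x y z

theorem finrank_range_ad_le_of_finrank_le [FiniteDimensional K L] {r : ℕ}
    (h : finrank K L ≤ finrank K (center K L) + (r + 1)) (x : L) :
    finrank K (LinearMap.range (ad K L x)) ≤ r := by
  by_cases hx : x ∈ center K L
  · exact (finrank_range_ad_of_mem_center hx).trans_le r.zero_le
  have hlt : (center K L).toSubmodule < LinearMap.ker (ad K L x) :=
    SetLike.lt_iff_le_and_exists.2 ⟨fun z hz => hz x, x, lie_self x, hx⟩
  have h₁ := Submodule.finrank_lt_finrank_of_lt hlt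
  have h₂ := (ad K L x).finrank_range_add_finrank_ker
  have h₃ : finrank K (center K L).toSubmodule = finrank K (center K L) := rfl
  omega

theorem finrank_range_prodMap {V V' W W' : Type*} [AddCommGroup V] [Module K V] [AddCommGroup V']
    [Module K V'] [AddCommGroup W] [Module K W] [AddCommGroup W'] [Module K W']
    [FiniteDimensional K V'] [FiniteDimensional K W'] (f : V →ₗ[K] V') (g : W →ₗ[K] W') :
    finrank K (LinearMap.range (f.prodMap g)) =
      finrank K (LinearMap.range f) + finrank K (LinearMap.range g) := by
  have h : LinearMap.range (f.prodMap g) = LinearMap.range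
      ((LinearMap.range f).subtype.prodMap (LinearMap.range g).subtype) := by
    simp only [LinearMap.range_prodMap, Submodule.range_subtype]
  rw [h, LinearMap.finrank_range_of_inj (Subtype.val_injective.prodMap Subtype.val_injective),
    finrank_prod]

theorem HasBreadth.prod [FiniteDimensional K L] [FiniteDimensional K M] {r s : ℕ}
    (hL : HasBreadth K L r) (hM : HasBreadth K M s) : HasBreadth K (L × M) (r + s) := by
  have hrank : ∀ (x : L) (y : M), finrank K (LinearMap.range (ad K (L × M) (x, y))) =
      finrank K (LinearMap.range (ad K L x)) + finrank K (LinearMap.range (ad K M y)) := by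
    intro x y
    exact finrank_range_prodMap (ad K L x) (ad K M y)
  obtain ⟨⟨x, hx⟩, hLle⟩ := hL
  obtain ⟨⟨y, hy⟩, hMle⟩ := hM
  refine ⟨⟨(x, y), (hrank x y).trans (congrArg₂ _ hx hy)⟩, ?_⟩
  rintro _ ⟨⟨x', y'⟩, rfl⟩
  exact (hrank x' y').trans_le (add_le_add (hLle ⟨x', rfl⟩) (hMle ⟨y', rfl⟩))

theorem lowerCentralSeries_one_le_center_prod (hL : lowerCentralSeries K L L 1 ≤ center K L)
    (hM : lowerCentralSeries K M M 1 ≤ center K M) :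
    lowerCentralSeries K (L × M) (L × M) 1 ≤ center K (L × M) := by
  rw [lowerCentralSeries_one_le_center_iff] at hL hM ⊢
  exact fun x y z => Prod.ext (hL x.1 y.1 z.1) (hM x.2 y.2 z.2)

theorem hasBreadth_of_finrank_le [FiniteDimensional K L] {r : ℕ} {x : L} {u : Fin r → L}
    (hu : LinearIndependent K fun i => ⁅x, u i⁆)
    (hle : ∀ y : L, finrank K (LinearMap.range (ad K L y)) ≤ r) : HasBreadth K L r := by
  exact ⟨⟨x, (hle x).antisymm (by
    simpa only [Fintype.card_fin] using
      card_le_finrank_of_forall_mem (S := LinearMap.range (ad K L x)) hu fun i => ⟨u i, rfl⟩)⟩,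
    Set.forall_mem_range.2 hle⟩

namespace BracketTable

variable {n : ℕ} (D : BracketTable K n)

/-- The standard basis of the Lie algebra of a bracket table. -/
noncomputable def basis : Basis (Fin n) K D.Alg := Pi.basisFun K (Fin n)

theorem basis_repr_lie (x y : D.Alg) (i : Fin n) :
    D.basis.repr ⁅x, y⁆ i = D.br (D.basis.repr x) (D.basis.repr y) i := rfl

theorem lowerCentralSeries_one_le_center : lowerCentralSeries K D.Alg D.Alg 1 ≤ center K D.Alg :=
  lowerCentralSeries_one_le_center_iff.2 D.nil

theorem hasBreadth_of_finrank_le {r : ℕ} {c : Fin r → Fin n} {x : Fin n → K}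
    {u : Fin r → Fin n → K} (hu : ∀ i j, D.br x (u j) (c i) = if i = j then 1 else 0)
    (hle : ∀ y : D.Alg, finrank K (LinearMap.range (ad K D.Alg y)) ≤ r) :
    HasBreadth K D.Alg r :=
  SympLie.hasBreadth_of_finrank_le (x := (x : D.Alg)) (u := u)
    (.of_pairwise_dual_eq_zero_one _ (fun i => D.basis.coord (c i))
      (fun i j hij => (hu i j).trans (if_neg hij)) fun i => (hu i i).trans (if_pos rfl)) hle

theorem hasBreadth_of_forall_br_eq_zero {r : ℕ} {c : Fin r → Fin n} {x : Fin n → K}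
    {u : Fin r → Fin n → K} (hu : ∀ i j, D.br x (u j) (c i) = if i = j then 1 else 0)
    (hc : ∀ y z : Fin n → K, (∀ i, D.br y z (c i) = 0) → D.br y z = 0) :
    HasBreadth K D.Alg r := by
  let p : D.Alg →ₗ[K] Fin r → K := LinearMap.funLeft K K c
  refine D.hasBreadth_of_finrank_le hu fun y => ?_
  have hinj : Function.Injective (p.domRestrict (LinearMap.range (ad K D.Alg y))) := by
    rw [injective_iff_map_eq_zero]
    rintro ⟨_, z, rfl⟩ hz
    exact Subtype.ext (hc y z (congrFun hz))
  simpa only [finrank_fin_fun] using LinearMap.finrank_le_finrank_of_injective hinj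

end BracketTable

theorem abelianTable_br {m : ℕ} (x y : Fin m → K) : (abelianTable K m).br x y = 0 := rfl

theorem n3_1Table_br (x y : Fin 3 → K) :
    (n3_1Table K).br x y = ![0, 0, x 0 * y 1 - x 1 * y 0] := rfl

theorem n5_5Table_br (x y : Fin 5 → K) :
    (n5_5Table K).br x y = ![0, 0, x 0 * y 1 - x 1 * y 0, 0, x 0 * y 3 - x 3 * y 0] := rfl

theorem n6_19Table_br (x y : Fin 6 → K) :
    (n6_19Table K).br x y = ![0, 0, x 0 * y 1 - x 1 * y 0, 0,
      (x 0 * y 3 - x 3 * y 0) + (x 1 * y 5 - x 5 * y 1), 0] := rfl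

theorem n6_20Table_br (x y : Fin 6 → K) :
    (n6_20Table K).br x y = ![0, 0, x 0 * y 1 - x 1 * y 0, 0, x 0 * y 3 - x 3 * y 0,
      x 1 * y 3 - x 3 * y 1] := rfl

theorem n6_20_1Table_br (x y : Fin 6 → K) :
    (n6_20_1Table K).br x y = ![0, 0, (x 0 * y 1 - x 1 * y 0) + (x 3 * y 5 - x 5 * y 3), 0,
      (x 0 * y 3 - x 3 * y 0) - (x 1 * y 5 - x 5 * y 1), 0] := rfl

theorem n7_124Table_br (x y : Fin 7 → K) :
    (n7_124Table K).br x y = ![0, 0, (x 0 * y 1 - x 1 * y 0) + (x 3 * y 6 - x 6 * y 3), 0,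
      (x 0 * y 3 - x 3 * y 0) + (x 5 * y 6 - x 6 * y 5), 0, 0] := rfl

variable (K)

theorem hasBreadth_ab (m : ℕ) : HasBreadth K (Ab K m) 0 :=
  (abelianTable K m).hasBreadth_of_forall_br_eq_zero (c := ![]) (x := 0) (u := ![])
    (fun i => i.elim0) fun _ _ _ => rfl

theorem hasBreadth_n3_1 : HasBreadth K (N3_1 K) 1 := by
  refine (n3_1Table K).hasBreadth_of_forall_br_eq_zero (c := ![2]) (x := Pi.single 0 1)
    (u := ![Pi.single 1 1]) ?_ ?_
  · simp [n3_1Table_br]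
  · simp [n3_1Table_br]

theorem hasBreadth_n5_5 : HasBreadth K (N5_5 K) 2 := by
  refine (n5_5Table K).hasBreadth_of_forall_br_eq_zero (c := ![2, 4]) (x := Pi.single 0 1)
    (u := ![Pi.single 1 1, Pi.single 3 1]) ?_ ?_
  · simp [Fin.forall_fin_two, n5_5Table_br]
  · simp +contextual [Fin.forall_fin_two, n5_5Table_br]

theorem hasBreadth_n6_19 : HasBreadth K (N6_19 K) 2 := by
  refine (n6_19Table K).hasBreadth_of_forall_br_eq_zero (c := ![2, 4]) (x := Pi.single 0 1)
    (u := ![Pi.single 1 1, Pi.single 3 1]) ?_ ?_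
  · simp [Fin.forall_fin_two, n6_19Table_br]
  · simp +contextual [Fin.forall_fin_two, n6_19Table_br]

theorem hasBreadth_n6_20_1 : HasBreadth K (N6_20_1 K) 2 := by
  refine (n6_20_1Table K).hasBreadth_of_forall_br_eq_zero (c := ![2, 4]) (x := Pi.single 0 1)
    (u := ![Pi.single 1 1, Pi.single 3 1]) ?_ ?_
  · simp [Fin.forall_fin_two, n6_20_1Table_br]
  · simp +contextual [Fin.forall_fin_two, n6_20_1Table_br]

theorem hasBreadth_n7_124 : HasBreadth K (N7_124 K) 2 := by
  refine (n7_124Table K).hasBreadth_of_forall_br_eq_zero (c := ![2, 4]) (x := Pi.single 0 1)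
    (u := ![Pi.single 1 1, Pi.single 3 1]) ?_ ?_
  · simp [Fin.forall_fin_two, n7_124Table_br]
  · simp +contextual [Fin.forall_fin_two, n7_124Table_br]

theorem hasBreadth_n6_20 : HasBreadth K (N6_20 K) 2 := by
  have hcenter : finrank K (N6_20 K) ≤ finrank K (center K (N6_20 K)) + 3 := by
    refine (finrank_le_finrank_center_add_finrank_span
      (φ := fun i => (n6_20Table K).basis.coord (![0, 1, 3] i)) fun z hz y => ?_).trans
      (Nat.add_le_add_left (finrank_range_le_card _) _)
    obtain ⟨h₀, h₁, h₃⟩ : z 0 = 0 ∧ z 1 = 0 ∧ z 3 = 0 := ⟨hz 0, hz 1, hz 2⟩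
    refine (n6_20Table_br y z).trans ?_
    simp only [h₀, h₁, h₃, mul_zero, sub_zero]
    exact funext fun i => by fin_cases i <;> rfl
  refine (n6_20Table K).hasBreadth_of_finrank_le (c := ![2, 4]) (x := Pi.single 0 1)
    (u := ![Pi.single 1 1, Pi.single 3 1]) ?_ (finrank_range_ad_le_of_finrank_le hcenter)
  simp [Fin.forall_fin_two, n6_20Table_br]

theorem isSymplectic_n7_124_prod_ab : IsSymplectic K (N7_124 K × Ab K 1) := by
  refine isSymplectic_of_basis ((n7_124Table K).basis.prod (abelianTable K 1).basis)
    (σ := ![.inl 2, .inl 6, .inl 1, .inl 5]) (τ := ![.inl 0, .inl 4, .inl 3, .inr 0])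
    (by decide) fun x y z => ?_
  simp only [wedge, LieAlgebra.Prod.bracket_apply, Basis.coord_apply, Fin.sum_univ_four,
    Matrix.cons_val_zero, Matrix.cons_val_one, Matrix.cons_val, Basis.prod_repr_inl,
    Basis.prod_repr_inr, BracketTable.basis_repr_lie, n7_124Table_br, abelianTable_br,
    Pi.zero_apply]
  ring

theorem isSymplectic_n6_19_prod_ab : IsSymplectic K (N6_19 K × Ab K 2) := by
  refine isSymplectic_of_basis ((n6_19Table K).basis.prod (abelianTable K 2).basis)
    (σ := ![.inl 4, .inl 5, .inl 1, .inr 0]) (τ := ![.inl 0, .inl 2, .inl 3, .inr 1])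
    (by decide) fun x y z => ?_
  simp only [wedge, LieAlgebra.Prod.bracket_apply, Basis.coord_apply, Fin.sum_univ_four,
    Matrix.cons_val_zero, Matrix.cons_val_one, Matrix.cons_val, Basis.prod_repr_inl,
    Basis.prod_repr_inr, BracketTable.basis_repr_lie, n6_19Table_br, abelianTable_br,
    Pi.zero_apply]
  ring

theorem isSymplectic_n6_20_prod_ab : IsSymplectic K (N6_20 K × Ab K 2) := by
  refine isSymplectic_of_basis ((n6_20Table K).basis.prod (abelianTable K 2).basis)
    (σ := ![.inl 2, .inl 4, .inl 5, .inr 0]) (τ := ![.inl 0, .inl 3, .inl 1, .inr 1])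
    (by decide) fun x y z => ?_
  simp only [wedge, LieAlgebra.Prod.bracket_apply, Basis.coord_apply, Fin.sum_univ_four,
    Matrix.cons_val_zero, Matrix.cons_val_one, Matrix.cons_val, Basis.prod_repr_inl,
    Basis.prod_repr_inr, BracketTable.basis_repr_lie, n6_20Table_br, abelianTable_br,
    Pi.zero_apply]
  ring

theorem isSymplectic_n6_20_1_prod_ab : IsSymplectic K (N6_20_1 K × Ab K 2) := by
  refine isSymplectic_of_basis ((n6_20_1Table K).basis.prod (abelianTable K 2).basis)
    (σ := ![.inl 2, .inl 5, .inl 1, .inr 0]) (τ := ![.inl 0, .inl 4, .inl 3, .inr 1])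
    (by decide) fun x y z => ?_
  simp only [wedge, LieAlgebra.Prod.bracket_apply, Basis.coord_apply, Fin.sum_univ_four,
    Matrix.cons_val_zero, Matrix.cons_val_one, Matrix.cons_val, Basis.prod_repr_inl,
    Basis.prod_repr_inr, BracketTable.basis_repr_lie, n6_20_1Table_br, abelianTable_br,
    Pi.zero_apply]
  ring

theorem isSymplectic_n5_5_prod_ab : IsSymplectic K (N5_5 K × Ab K 3) := by
  refine isSymplectic_of_basis ((n5_5Table K).basis.prod (abelianTable K 3).basis)
    (σ := ![.inl 2, .inl 4, .inl 1, .inr 1]) (τ := ![.inl 0, .inl 3, .inr 0, .inr 2])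
    (by decide) fun x y z => ?_
  simp only [wedge, LieAlgebra.Prod.bracket_apply, Basis.coord_apply, Fin.sum_univ_four,
    Matrix.cons_val_zero, Matrix.cons_val_one, Matrix.cons_val, Basis.prod_repr_inl,
    Basis.prod_repr_inr, BracketTable.basis_repr_lie, n5_5Table_br, abelianTable_br,
    Pi.zero_apply]
  ring

theorem isSymplectic_n3_1_prod_n3_1_prod_ab : IsSymplectic K (N3_1 K × N3_1 K × Ab K 2) := by
  refine isSymplectic_of_basis
    ((n3_1Table K).basis.prod ((n3_1Table K).basis.prod (abelianTable K 2).basis))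
    (σ := ![.inl 2, .inr (.inl 2), .inl 1, .inr (.inr 0)])
    (τ := ![.inl 0, .inr (.inl 0), .inr (.inl 1), .inr (.inr 1)]) (by decide) fun x y z => ?_
  simp only [wedge, LieAlgebra.Prod.bracket_apply, Basis.coord_apply, Fin.sum_univ_four,
    Matrix.cons_val_zero, Matrix.cons_val_one, Matrix.cons_val, Basis.prod_repr_inl,
    Basis.prod_repr_inr, BracketTable.basis_repr_lie, n3_1Table_br, abelianTable_br,
    Pi.zero_apply]
  ring

theorem isSymplecticOfType221111_alg_prod_ab {n m : ℕ} {D : BracketTable K n} (hnm : n + m = 8)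
    (hs : IsSymplectic K (D.Alg × Ab K m)) (hb : HasBreadth K D.Alg 2) :
    IsSymplecticOfType221111 K (D.Alg × Ab K m) := by
  refine (isSymplecticOfType221111_iff K _).2 ⟨?_, ?_, hs, hb.prod (hasBreadth_ab K m)⟩
  · rw [finrank_prod, BracketTable.finrank_alg, BracketTable.finrank_alg, hnm]
  · exact lowerCentralSeries_one_le_center_prod D.lowerCentralSeries_one_le_center
      (abelianTable K m).lowerCentralSeries_one_le_center

theorem isSymplecticOfType221111_n3_1_prod_n3_1_prod_ab :
    IsSymplecticOfType221111 K (N3_1 K × N3_1 K × Ab K 2) := by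
  refine (isSymplecticOfType221111_iff K _).2 ⟨?_, ?_, isSymplectic_n3_1_prod_n3_1_prod_ab K,
    (hasBreadth_n3_1 K).prod ((hasBreadth_n3_1 K).prod (hasBreadth_ab K 2))⟩
  · simp only [finrank_prod, BracketTable.finrank_alg]
  · exact lowerCentralSeries_one_le_center_prod (n3_1Table K).lowerCentralSeries_one_le_center
      (lowerCentralSeries_one_le_center_prod (n3_1Table K).lowerCentralSeries_one_le_center
        (abelianTable K 2).lowerCentralSeries_one_le_center)

theorem isSymplecticOfType221111_n6_20_1_prod_ab :
    IsSymplecticOfType221111 K (N6_20_1 K × Ab K 2) :=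
  isSymplecticOfType221111_alg_prod_ab K rfl (isSymplectic_n6_20_1_prod_ab K) (hasBreadth_n6_20_1 K)

theorem IsInCommonList.isSymplecticOfType221111 (h : IsInCommonList K L) :
    IsSymplecticOfType221111 K L := by
  rcases h with ⟨⟨e⟩⟩ | ⟨⟨e⟩⟩ | ⟨⟨e⟩⟩ | ⟨⟨e⟩⟩ | ⟨⟨e⟩⟩
  · exact .of_equiv e (isSymplecticOfType221111_alg_prod_ab K rfl (isSymplectic_n7_124_prod_ab K)
      (hasBreadth_n7_124 K))
  · exact .of_equiv e (isSymplecticOfType221111_alg_prod_ab K rfl (isSymplectic_n6_19_prod_ab K)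
      (hasBreadth_n6_19 K))
  · exact .of_equiv e (isSymplecticOfType221111_alg_prod_ab K rfl (isSymplectic_n6_20_prod_ab K)
      (hasBreadth_n6_20 K))
  · exact .of_equiv e (isSymplecticOfType221111_alg_prod_ab K rfl (isSymplectic_n5_5_prod_ab K)
      (hasBreadth_n5_5 K))
  · exact .of_equiv e (isSymplecticOfType221111_n3_1_prod_n3_1_prod_ab K)

end Models

section Family

open Module
open LieAlgebra (ad center)
open LieModule (lowerCentralSeries)

variable {K L : Type*} [Field K] [LieRing L] [LieAlgebra K L]

theorem lie_mem_of_basis {ι : Type*} (X : Basis ι K L) {S : Submodule K L}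
    (h : ∀ i j, ⁅X i, X j⁆ ∈ S) (x y : L) : ⁅x, y⁆ ∈ S :=
  LinearMap.BilinMap.apply_apply_mem_of_mem_span S (Set.range X) (Set.range X)
    (LieModule.toEnd K L L : L →ₗ[K] Module.End K L)
    (by rintro _ ⟨i, rfl⟩ _ ⟨j, rfl⟩; exact h i j) x y (X.mem_span x) (X.mem_span y)

theorem mem_center_of_basis {ι : Type*} (X : Basis ι K L) {z : L} (h : ∀ i, ⁅z, X i⁆ = 0) :
    z ∈ center K L := fun y => by
  have hz : ad K L z = 0 := X.ext h
  rw [← lie_skew, ← LieAlgebra.ad_apply (R := K), hz, LinearMap.zero_apply, neg_zero]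

theorem IsInComponentOne.exists_lowerCentralSeries_eq_span_pair (h : IsInComponentOne K L) :
    ∃ w₁ w₂ : L, LinearIndependent K ![w₁, w₂] ∧ w₁ ∈ center K L ∧ w₂ ∈ center K L ∧
      (lowerCentralSeries K L L 1).toSubmodule = Submodule.span K {w₁, w₂} := by
  obtain ⟨X, a₃, a₅, h₁, h₃, h₀, hG, hX₂, hX₄⟩ := h
  have hX₂mem : X 2 ∈ Submodule.span K {X 2, X 4} := Submodule.mem_span_of_mem (.inl rfl)
  have hX₄mem : X 4 ∈ Submodule.span K {X 2, X 4} := Submodule.mem_span_of_mem (.inr rfl)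
  set S := Submodule.span K {X 2, X 4}
  have hcases : ∀ i : Fin 8, i = 0 ∨ i = 2 ∨ i = 4 ∨ i = 1 ∨ i = 3 ∨
      i ∈ ({5, 6, 7} : Set (Fin 8)) := by
    simp [Fin.forall_fin_succ]
  have hskew : ∀ i j, ⁅X j, X i⁆ ∈ S → ⁅X i, X j⁆ ∈ S := fun i j hij =>
    lie_skew (X i) (X j) ▸ S.neg_mem hij
  have hX₀ : ∀ j, ⁅X 0, X j⁆ ∈ S := fun j => by
    rcases hcases j with rfl | rfl | rfl | rfl | rfl | hj
    · exact (lie_self (X 0)).symm ▸ S.zero_mem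
    · exact hskew 0 2 (hX₂ 0 ▸ S.zero_mem)
    · exact hskew 0 4 (hX₄ 0 ▸ S.zero_mem)
    · exact h₁ ▸ hX₂mem
    · exact h₃ ▸ hX₄mem
    · exact h₀ j hj ▸ S.zero_mem
  have hX : ∀ i j, ⁅X i, X j⁆ ∈ S := fun i j => by
    rcases hcases i with rfl | rfl | rfl | hi
    · exact hX₀ j
    · exact hX₂ j ▸ S.zero_mem
    · exact hX₄ j ▸ S.zero_mem
    rcases hcases j with rfl | rfl | rfl | hj
    · exact hskew i 0 (hX₀ i)
    · exact hskew i 2 (hX₂ i ▸ S.zero_mem)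
    · exact hskew i 4 (hX₄ i ▸ S.zero_mem)
    · exact hG i hi j hj ▸ S.add_mem (S.smul_mem _ hX₂mem) (S.smul_mem _ hX₄mem)
  refine ⟨X 2, X 4, ?_, mem_center_of_basis X hX₂, mem_center_of_basis X hX₄, le_antisymm
    (lowerCentralSeries_one_le_iff.2 (lie_mem_of_basis X hX)) (Submodule.span_le.2 ?_)⟩
  · convert X.linearIndependent.comp ![2, 4] (by decide) using 1
    ext i : 1
    fin_cases i <;> rfl
  · rintro _ (rfl | rfl)
    exacts [h₁ ▸ lie_mem_lowerCentralSeries_one _ _, h₃ ▸ lie_mem_lowerCentralSeries_one _ _]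

theorem IsInComponentOne.finrank_eq (h : IsInComponentOne K L) : finrank K L = 8 := by
  obtain ⟨X, -⟩ := h
  exact finrank_eq_card_basis X

theorem IsInComponentOne.isDecomposable (h : IsInComponentOne K L) (hs : IsSymplectic K L) :
    IsDecomposable K L := by
  obtain ⟨w₁, w₂, hw, hw₁, hw₂, hder⟩ := h.exists_lowerCentralSeries_eq_span_pair
  have : FiniteDimensional K L := .of_finrank_pos (h.finrank_eq ▸ Nat.succ_pos 7)
  refine isDecomposable_of_lowerCentralSeries_eq_span_pair hs hw hder ?_ h.finrank_eq.ge
  rw [← LieSubmodule.toSubmodule_le_toSubmodule, hder]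
  exact Submodule.span_le.2 (Set.pair_subset hw₁ hw₂)

end Family

section MainTheorem

theorem infinite_of_forall_isSquare {K : Type*} [Field K] (h2 : (2 : K) ≠ 0)
    (hsq : ∀ x : K, IsSquare x) : Infinite K := by
  by_contra hK
  have : Finite K := not_infinite_iff_finite.1 hK
  obtain ⟨x, hx⟩ := FiniteField.exists_nonsquare (F := K) fun h => h2 <| by
    simpa only [h, Nat.cast_ofNat] using ringChar.Nat.cast_ringChar (R := K)
  exact hx (hsq x)

theorem mainTheorem2_general {K : Type*} [Field K] {L : Type*} [LieRing L] [LieAlgebra K L] :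
    (Infinite K → IsSymplecticOfType221111 K L → IsDecomposable K L) ∧
    (IsInComponentOne K L → IsSymplectic K L → IsDecomposable K L) ∧
    ((2 : K) ≠ 0 → (∀ x : K, IsSquare x) →
      (IsSymplecticOfType221111 K L ↔ IsInCommonList K L)) ∧
    (Infinite K → (2 : K) ≠ 0 → (∀ x : K, IsSquare x ∨ IsSquare (-x)) →
      (IsSymplecticOfType221111 K L ↔
        (IsInCommonList K L ∨ Nonempty (L ≃ₗ⁅K⁆ N6_20_1 K × Ab K 2)))) := by
  refine ⟨fun _ h => h.isDecomposable, IsInComponentOne.isDecomposable, fun h2 hsq => ?_,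
    fun _ h2 hsq => ?_⟩
  · have := infinite_of_forall_isSquare h2 hsq
    exact ⟨(·.isInCommonList h2 hsq), (·.isSymplecticOfType221111)⟩
  · refine ⟨(·.isInCommonList_or_nonempty_lieEquiv_n6_20_1 h2 hsq), ?_⟩
    rintro (h | ⟨⟨e⟩⟩)
    exacts [h.isSymplecticOfType221111, .of_equiv e (isSymplecticOfType221111_n6_20_1_prod_ab K)]

end MainTheorem

end SympLie

theorem mainTheorem2 :
    (∀ (K : Type*) [RCLike K] (L : Type*) [LieRing L] [LieAlgebra K L],
      SympLie.IsSymplecticOfType221111 K L → SympLie.IsDecomposable K L) ∧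
    (∀ (K : Type*) [RCLike K] (L : Type*) [LieRing L] [LieAlgebra K L],
      SympLie.IsInComponentOne K L → SympLie.IsSymplectic K L → SympLie.IsDecomposable K L) ∧
    (∀ (L : Type*) [LieRing L] [LieAlgebra ℂ L],
      SympLie.IsSymplecticOfType221111 ℂ L ↔ SympLie.IsInCommonList ℂ L) ∧
    (∀ (L : Type*) [LieRing L] [LieAlgebra ℝ L],
      SympLie.IsSymplecticOfType221111 ℝ L ↔
        (SympLie.IsInCommonList ℝ L ∨
          Nonempty (L ≃ₗ⁅ℝ⁆ SympLie.N6_20_1 ℝ × SympLie.Ab ℝ 2))) :=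
  ⟨fun _ _ _ _ _ => SympLie.mainTheorem2_general.1 inferInstance,
    fun _ _ _ _ _ => SympLie.mainTheorem2_general.2.1,
    fun _ _ _ => SympLie.mainTheorem2_general.2.2.1 two_ne_zero IsAlgClosed.exists_eq_mul_self,
    fun _ _ _ => SympLie.mainTheorem2_general.2.2.2 inferInstance two_ne_zero fun x =>
      (le_total 0 x).imp Real.isSquare_iff.2 fun hx => Real.isSquare_iff.2 (neg_nonneg.2 hx)⟩
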